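/- Let $0<\beta<\gamma<1$, $0\le\mu\le1$, $p>1/\beta$, $K\ge 0$ and $b\in\mathbb{R}$ ($b$ may be negative). Here $C_{1-\beta}(0,\infty)$ is the set of continuous $x:(0,\infty)\to\mathbb{R}$ for which $t^{1-\beta}x(t)$ extends continuously to $[0,\infty)$, and $L^p_{\mathrm{Loc}}[0,\infty)$ is the set of real functions that are $L^p$ on every bounded subinterval of $[0,\infty)$. For $x<0$, $x^\mu$ denotes any fixed real-valued convention with $|x^\mu|=|x|^\mu$ (for instance $|x|^\mu$ or $\operatorname{sgn}(x)|x|^\mu$), and $0^0=1$. Let $l,l_1,k,k_1:(0,\infty)\to\mathbb{R}$ be such that $t^{(1-\mu)(1-\beta)}l(t)$, $t^{(1-\mu)(1-\beta)}l_1(t)$, $t^{1-\beta}k(t)$ and $t^{1-\beta}k_1(t)$ belong to $C(0,\infty)\cap L^p_{\mathrm{Loc}}[0,\infty)$, such that $t^\gamma|l(t)|\le K$ and $t^\gamma|l_1(t)|\le K$ for all $t\in[1,\infty)$, and such that $$\lim_{t\to\infty}t^\beta k(t)=\lim_{t\to\infty}t^\beta k_1(t)=b.$$ Let $f:(0,\infty)\times\mathbb{R}\to\mathbb{R}$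 be continuous with $$l_1(t)x^\mu+k_1(t)\le f(t,x)\le l(t)x^\mu+k(t)\qquad\text{for all }(t,x)\in(0,\infty)\times\mathbb{R}.$$ Then for every $x_0\in\mathbb{R}$ the Riemann–Liouville problem $$D_{0^+}^{\beta}x(t)=f(t,x(t))\quad(t\in(0,\infty)),\qquad \lim_{t\to0^+}t^{1-\beta}x(t)=x_0,$$ where $$D_{0^+}^{\beta}x(t)=\frac{d}{dt}I_{0^+}^{1-\beta}x(t),\qquad I_{0^+}^{1-\beta}x(t)=\frac1{\Gamma(1-\beta)}\int_0^t\frac{x(s)}{(t-s)^{\beta}}\,ds,$$ and where being a solution includes that $x$ is integrable on $[0,T]$ and that $I_{0^+}^{1-\beta}x$ (extended to $t=0$ by its limit) is absolutely continuous on $[0,T]$ for every $T>0$, has at least one solution $x\in C_{1-\beta}(0,\infty)$ with $$\lim_{t\to\infty}x(t)=\frac{b\pi}{\Gamma(\beta)\sin(\beta\pi)}.$$ -/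

import Mathlib

open Real Set Filter Topology MeasureTheory

/-- The Riemann-Liouville fractional integral of order `α`,
`I^α ρ(t) = (1/Γ(α)) ∫₀ᵗ ρ(s) / (t-s)^(1-α) ds`. -/
noncomputable def rlIntegral (α : ℝ) (ρ : ℝ → ℝ) (t : ℝ) : ℝ :=
  1 / Real.Gamma α * ∫ s in (0 : ℝ)..t, ρ s / (t - s) ^ (1 - α)

/-- `D^β ρ = g` on `(0,∞)` in the Riemann-Liouville sense: `ρ` is integrable on every `[0,T]`,
`I^(1-β) ρ` is absolutely continuous on every `(0,T]`, i.e. it agrees there with an absolutely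
continuous function on `[0,T]` (the value at `0` is its limit there, which the integral formula
does not see), and `d/dt I^(1-β) ρ (t) = g t` for every `t > 0`. -/
structure HasRLDeriv (β : ℝ) (ρ g : ℝ → ℝ) : Prop where
  integrable : ∀ T : ℝ, 0 < T → IntervalIntegrable ρ volume 0 T
  absCont : ∀ T : ℝ, 0 < T → ∃ G : ℝ → ℝ, AbsolutelyContinuousOnInterval G 0 T ∧
    ∀ t ∈ Ioc 0 T, rlIntegral (1 - β) ρ t = G t
  hasDerivAt : ∀ t : ℝ, 0 < t → HasDerivAt (rlIntegral (1 - β) ρ) (g t) t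

/-- `x` solves `D^β x(t) = f(t, x(t))` for `t ∈ (0,∞)`, `lim_{t → 0+} t^(1-β) x(t) = x₀`. -/
structure IsRLSolution (β : ℝ) (f : ℝ → ℝ → ℝ) (x₀ : ℝ) (x : ℝ → ℝ) : Prop where
  equation : HasRLDeriv β x (fun t => f t (x t))
  initial : Tendsto (fun t => t ^ (1 - β) * x t) (𝓝[>] 0) (𝓝 x₀)

/-- The space `C_α(0,∞)`: `x` is continuous on `(0,∞)` and `t^α x(t)` extends continuously
to `[0,∞)`. -/
def MemCWeighted (α : ℝ) (x : ℝ → ℝ) : Prop :=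
  ContinuousOn x (Ioi 0) ∧ ∃ L : ℝ, Tendsto (fun t => t ^ α * x t) (𝓝[>] 0) (𝓝 L)

/-- The space `C(0,∞) ∩ L^p_loc[0,∞)`. -/
def MemCLpLoc (p : ℝ) (g : ℝ → ℝ) : Prop :=
  ContinuousOn g (Ioi 0) ∧
    ∀ T : ℝ, 0 < T → MemLp g (ENNReal.ofReal p) (volume.restrict (Icc 0 T))

/-- `P` is a real-valued version on all of `ℝ` of the power function `x ↦ x^μ`: it is the usual
power for `x ≥ 0`, and `|P x| = |x|^μ` for `x < 0`. This covers every convention for real powers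
of negative numbers, such as `|x|^μ` (as for `μ = 2/3`) and `sgn(x)|x|^μ` (as for `μ = 1/3` and
`μ = 1`). -/
def IsRealPower (μ : ℝ) (P : ℝ → ℝ) : Prop :=
  (∀ x : ℝ, 0 ≤ x → P x = x ^ μ) ∧ ∀ x : ℝ, x < 0 → |P x| = |x| ^ μ

/-! Integrating the equation gives the singular Volterra equation x(t) = x₀ t^(β-1) + (1/Γ(β)) ∫₀ᵗ
(t-s)^(β-1) f(s, x(s)) ds. With x = t^(β-1) y, the sandwich becomes affine growth |f(s, s^(β-1) v)|
≤ φ(s)(1 + |v|), where φ is s^(β-1) times a sum of absolute values of locally L^p functions.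

Since p > 1/β, some a satisfies 1/p < a < β, and Young's inequality shows that even the Abel
integrals of φ of order a are O(t^(β-1)) (`abelWeight_of_memCLpLoc`). The surplus β - a drives the
existence proof: it gives t^(β-a) near 0 (initial condition), |t₂ - t₁|^(β-a) (equicontinuity), and
l^(a-β) against the growth e^(lt) (a priori bounds without smallness).

As f is merely continuous, no contraction is available. Delaying the unknown by δ makes the equation
solvable in finitely many iterations on each bounded interval, with bounds uniform in δ
(`exists_delayed_solution`). Arzelà–Ascoli and dominated convergence let δ → 0
(`exists_volterra_solution`). The semigroup law I^(1-β) I^β = I^1, from Fubini and the Beta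
integral, returns to the differential equation (`hasRLDeriv_of_volterra`).

At infinity, γ > β yields |f(s,x)| ≤ (η|x| + C) s^(-β) for large s, with η as small as desired. The
integral of (t-s)^(β-1) s^(-β) over (0,t) equals Γ(β)Γ(1-β) for every t, so a small η is absorbed
and x is bounded (`volterra_solution_bounded`). Then t^β f(t, x(t)) → b, whence x(t) → b Γ(1-β)
(`tendsto_abelIntegral_atTop`), and the reflection formula gives the stated limit. -/

/-! ### Abel integrals and their dominating weights -/

/-- The unnormalised Abel integral `∫₀ᵗ (t - s)^(β-1) F(s) ds`. -/
noncomputable def abelIntegral (β : ℝ) (F : ℝ → ℝ) (t : ℝ) : ℝ :=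
  ∫ s in Ioc 0 t, (t - s) ^ (β - 1) * F s

lemma rlIntegral_eq_abelIntegral (β : ℝ) (F : ℝ → ℝ) {t : ℝ} (ht : 0 ≤ t) :
    rlIntegral β F t = 1 / Real.Gamma β * abelIntegral β F t := by
  unfold rlIntegral abelIntegral
  rw [intervalIntegral.integral_of_le ht]
  congr 1
  refine setIntegral_congr_fun measurableSet_Ioc fun s hs => ?_
  have : 0 ≤ t - s := by linarith [hs.2]
  rw [show β - 1 = -(1 - β) by ring, rpow_neg this]
  field_simp

/-- Pointwise bound of the two-sided singular kernel by a sum of one-sided ones. -/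
lemma two_sided_kernel_le {β a s t : ℝ} (hβ : 0 < β) (hβ1 : β < 1) (haβ : a ≤ β)
    (hs : 0 < s) (hst : s < t) :
    (t - s) ^ (a - 1) * s ^ (β - 1) ≤
      2 * t ^ (β - 1) * ((t - s) ^ (a - 1) + s ^ (a - 1)) := by
  have key : ∀ r, t / 2 ≤ r → r ^ (β - 1) ≤ 2 * t ^ (β - 1) := by
    intro r hr
    have ht : 0 < t := by linarith
    have h1 : r ^ (β - 1) ≤ (t / 2) ^ (β - 1) :=
      rpow_le_rpow_of_nonpos (by linarith) hr (by linarith)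
    have h2 : (t / 2) ^ (β - 1) = t ^ (β - 1) * 2 ^ (1 - β) := by
      rw [div_rpow ht.le (by norm_num), div_eq_mul_inv, ← rpow_neg (by norm_num)]
      congr 2; ring
    have h3 : (2 : ℝ) ^ (1 - β) ≤ 2 ^ (1 : ℝ) :=
      rpow_le_rpow_of_exponent_le (by norm_num) (by linarith)
    rw [rpow_one] at h3
    have h4 : 0 ≤ t ^ (β - 1) := by positivity
    nlinarith
  have hts : 0 < t - s := by linarith
  have ht : 0 < t := by linarith
  have p1 : 0 < (t - s) ^ (a - 1) := by positivity
  have p2 : 0 < s ^ (a - 1) := by positivity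
  have p3 : 0 < t ^ (β - 1) := by positivity
  rcases le_total (t / 2) s with h | h
  · have := key s h
    nlinarith [mul_le_mul_of_nonneg_left this p1.le, mul_pos p3 p2]
  · have h1 := key (t - s) (by linarith)
    -- As s ≤ t - s here, the two exponents can be swapped, so that β - 1 falls on the factor t - s,
    -- which is at least t/2.
    have h2 : (t - s) ^ (a - 1) * s ^ (β - 1) ≤ (t - s) ^ (β - 1) * s ^ (a - 1) := by
      have e1 : (t - s) ^ (a - 1) = (t - s) ^ (β - 1) * (t - s) ^ (a - β) := by
        rw [← rpow_add hts]; congr 1; ring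
      have e2 : s ^ (a - 1) = s ^ (β - 1) * s ^ (a - β) := by
        rw [← rpow_add hs]; congr 1; ring
      have e3 : (t - s) ^ (a - β) ≤ s ^ (a - β) :=
        rpow_le_rpow_of_nonpos hs (by linarith) (by linarith)
      rw [e1, e2]
      have : 0 ≤ (t - s) ^ (β - 1) * s ^ (β - 1) := by positivity
      nlinarith [mul_le_mul_of_nonneg_left e3 this]
    nlinarith [mul_le_mul_of_nonneg_right h1 p2.le, mul_pos p3 p1]

/-- `φ` is a weight whose Abel integrals of order `a` are `O(t^(β-1))` on bounded intervals. -/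
def AbelWeight (β a : ℝ) (φ : ℝ → ℝ) : Prop :=
  ∀ T : ℝ, 0 < T → ∃ C : ℝ, 0 ≤ C ∧ ∀ t : ℝ, 0 < t → t ≤ T →
    IntegrableOn (fun s => (t - s) ^ (a - 1) * φ s) (Ioc 0 t) ∧
      ∫ s in Ioc 0 t, (t - s) ^ (a - 1) * φ s ≤ C * t ^ (β - 1)

lemma integrableOn_sub_rpow {r t : ℝ} (hr : -1 < r) (ht : 0 ≤ t) :
    IntegrableOn (fun s => (t - s) ^ r) (Ioc 0 t) := by
  have := (intervalIntegral.intervalIntegrable_rpow' (a := 0) (b := t) hr).comp_sub_left t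
  simp only [sub_zero, sub_self] at this
  exact (intervalIntegrable_iff_integrableOn_Ioc_of_le ht).1 this.symm

lemma integral_sub_rpow {r t : ℝ} (hr : -1 < r) (ht : 0 ≤ t) :
    ∫ s in Ioc 0 t, (t - s) ^ r = t ^ (r + 1) / (r + 1) := by
  rw [← intervalIntegral.integral_of_le ht,
    intervalIntegral.integral_comp_sub_left (fun s => s ^ r) t, sub_self, sub_zero,
    integral_rpow (Or.inl hr), zero_rpow (by linarith), sub_zero]

lemma integrableOn_rpow_Ioc {r t : ℝ} (hr : -1 < r) (ht : 0 ≤ t) :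
    IntegrableOn (fun s : ℝ => s ^ r) (Ioc 0 t) :=
  (intervalIntegrable_iff_integrableOn_Ioc_of_le ht).1
    (intervalIntegral.intervalIntegrable_rpow' hr)

lemma integral_rpow_Ioc {r t : ℝ} (hr : -1 < r) (ht : 0 ≤ t) :
    ∫ s in Ioc 0 t, s ^ r = t ^ (r + 1) / (r + 1) := by
  rw [← intervalIntegral.integral_of_le ht,
    integral_rpow (Or.inl hr), zero_rpow (by linarith), sub_zero]

/-- An `L^p` function times `s^(β-1)` is an Abel weight for orders `a > 1/p`. -/
lemma abelWeight_of_memCLpLoc {β a p : ℝ} {h : ℝ → ℝ} (hβ : 0 < β) (hβ1 : β < 1) (haβ : a ≤ β)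
    (hp : 1 / p < a) (hp1 : 1 < p) (hh : MemCLpLoc p h) :
    AbelWeight β a (fun s => s ^ (β - 1) * |h s|) := by
  intro T hT
  set q := p.conjExponent with hq
  have hpq : p.HolderConjugate q := Real.HolderConjugate.conjExponent hp1
  have hq1 : 1 < q := hpq.symm.lt
  -- The condition a > 1/p says exactly that z^((a-1)q) is integrable at 0.
  have hr : -1 < (a - 1) * q := by
    have e := hpq.inv_add_inv_eq_one
    have : q⁻¹ = 1 - 1 / p := by rw [one_div]; linarith
    have h2 : 1 - a < q⁻¹ := by rw [this]; linarith
    have : (1 - a) * q < q⁻¹ * q := mul_lt_mul_of_pos_right h2 (by linarith)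
    rw [inv_mul_cancel₀ (by linarith)] at this
    linarith
  set r := (a - 1) * q with hrdef
  have hint : IntegrableOn (fun s => |h s| ^ p) (Icc 0 T) := by
    have := (hh.2 T hT).integrable_norm_rpow (by simp; linarith) (by simp)
    rw [ENNReal.toReal_ofReal (by linarith)] at this
    exact this
  have hmeas : AEStronglyMeasurable h (volume.restrict (Icc 0 T)) := (hh.2 T hT).1
  refine ⟨4 * (T ^ (r + 1) / (r + 1)) + 4 * ∫ s in Icc 0 T, |h s| ^ p, ?_, ?_⟩
  · have : 0 ≤ ∫ s in Icc 0 T, |h s| ^ p := integral_nonneg fun s => by positivity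
    have : 0 ≤ T ^ (r + 1) / (r + 1) := div_nonneg (by positivity) (by linarith)
    linarith
  intro t ht htT
  have hsub : Ioc 0 t ⊆ Icc 0 T := fun s hs => ⟨hs.1.le, hs.2.trans htT⟩
  have hint' : IntegrableOn (fun s => |h s| ^ p) (Ioc 0 t) := hint.mono_set hsub
  have hbd : ∀ s ∈ Ioo 0 t, (t - s) ^ (a - 1) * (s ^ (β - 1) * |h s|) ≤
      2 * t ^ (β - 1) * ((t - s) ^ r + s ^ r + 2 * |h s| ^ p) := by
    intro s hs
    have hts : 0 < t - s := by linarith [hs.2]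
    have k := two_sided_kernel_le hβ hβ1 haβ hs.1 hs.2
    have yg : ∀ z : ℝ, 0 < z → z ^ (a - 1) * |h s| ≤ z ^ r + |h s| ^ p := by
      intro z hz
      have := Real.young_inequality_of_nonneg (a := |h s|) (b := z ^ (a - 1)) (abs_nonneg _)
        (by positivity) hpq
      rw [← rpow_mul hz.le, ← hrdef] at this
      have h1 : z ^ r / q ≤ z ^ r := div_le_self (by positivity) hq1.le
      have h2 : |h s| ^ p / p ≤ |h s| ^ p := div_le_self (by positivity) hp1.le
      linarith
    have y1 := yg _ hts
    have y2 := yg _ hs.1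
    have h0 := abs_nonneg (h s)
    have ht' : 0 ≤ 2 * t ^ (β - 1) := by positivity
    calc _ = (t - s) ^ (a - 1) * s ^ (β - 1) * |h s| := by ring
      _ ≤ 2 * t ^ (β - 1) * ((t - s) ^ (a - 1) + s ^ (a - 1)) * |h s| :=
        mul_le_mul_of_nonneg_right k h0
      _ = 2 * t ^ (β - 1) * ((t - s) ^ (a - 1) * |h s| + s ^ (a - 1) * |h s|) := by ring
      _ ≤ _ := mul_le_mul_of_nonneg_left (by linarith) ht'
  have hae : ∀ᵐ s ∂(volume.restrict (Ioc 0 t)), s ∈ Ioo 0 t := by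
    rw [← restrict_Ioo_eq_restrict_Ioc]; exact ae_restrict_mem measurableSet_Ioo
  have i1 := integrableOn_sub_rpow hr ht.le
  have i2 := integrableOn_rpow_Ioc hr ht.le
  have idom : IntegrableOn (fun s => 2 * t ^ (β - 1) * ((t - s) ^ r + s ^ r + 2 * |h s| ^ p))
      (Ioc 0 t) := ((i1.add i2).add (hint'.const_mul 2)).const_mul _
  have iint : IntegrableOn (fun s => (t - s) ^ (a - 1) * (s ^ (β - 1) * |h s|)) (Ioc 0 t) := by
    refine idom.mono' ?_ ?_
    · have : AEStronglyMeasurable h (volume.restrict (Ioc 0 t)) :=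
        hmeas.mono_measure (Measure.restrict_mono hsub le_rfl)
      have m1 : Measurable fun s : ℝ => (t - s) ^ (a - 1) := by fun_prop
      have m2 : Measurable fun s : ℝ => s ^ (β - 1) := by fun_prop
      exact m1.aestronglyMeasurable.mul (m2.aestronglyMeasurable.mul this.norm)
    · filter_upwards [hae] with s hs
      have hts : 0 < t - s := by linarith [hs.2]
      have hs0 := hs.1
      rw [Real.norm_of_nonneg (by positivity)]
      exact hbd s hs
  refine ⟨iint, ?_⟩
  have hT1 : t ^ (r + 1) / (r + 1) ≤ T ^ (r + 1) / (r + 1) :=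
    div_le_div_of_nonneg_right (rpow_le_rpow ht.le htT (by linarith)) (by linarith)
  have hT2 : ∫ s in Ioc 0 t, |h s| ^ p ≤ ∫ s in Icc 0 T, |h s| ^ p :=
    setIntegral_mono_set hint (ae_of_all _ fun s => by positivity) hsub.eventuallyLE
  calc _ ≤ ∫ s in Ioc 0 t, 2 * t ^ (β - 1) * ((t - s) ^ r + s ^ r + 2 * |h s| ^ p) := by
        refine integral_mono_ae iint idom ?_
        filter_upwards [hae] with s hs using hbd s hs
    _ = 2 * t ^ (β - 1) * (t ^ (r + 1) / (r + 1) + t ^ (r + 1) / (r + 1) +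
          2 * ∫ s in Ioc 0 t, |h s| ^ p) := by
        have e1 := integral_add (i1.add i2) (hint'.const_mul 2)
        simp only [Pi.add_apply] at e1
        rw [integral_const_mul, e1, integral_add i1 i2,
          integral_const_mul, integral_sub_rpow hr ht.le, integral_rpow_Ioc hr ht.le]
    _ ≤ _ := by
        have ht' : 0 ≤ t ^ (β - 1) := by positivity
        nlinarith

lemma AbelWeight.add {β a : ℝ} {φ ψ : ℝ → ℝ} (hφ : AbelWeight β a φ) (hψ : AbelWeight β a ψ) :
    AbelWeight β a (fun s => φ s + ψ s) := by
  intro T hT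
  obtain ⟨C, hC0, hC⟩ := hφ T hT
  obtain ⟨D, hD0, hD⟩ := hψ T hT
  refine ⟨C + D, by positivity, fun t ht htT => ?_⟩
  obtain ⟨i1, b1⟩ := hC t ht htT
  obtain ⟨i2, b2⟩ := hD t ht htT
  simp only [mul_add]
  refine ⟨i1.add i2, ?_⟩
  rw [integral_add i1 i2]
  linarith

/-! ### Bounds, increments and equicontinuity of Abel integrals -/

lemma ae_restrict_Ioc_mem_Ioo (t : ℝ) : ∀ᵐ s ∂(volume.restrict (Ioc 0 t)), s ∈ Ioo 0 t := by
  rw [← restrict_Ioo_eq_restrict_Ioc]; exact ae_restrict_mem measurableSet_Ioo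

lemma aestronglyMeasurable_Ioc_of_continuousOn {F : ℝ → ℝ} (hF : ContinuousOn F (Ioi 0)) (t : ℝ) :
    AEStronglyMeasurable F (volume.restrict (Ioc 0 t)) :=
  (hF.aestronglyMeasurable measurableSet_Ioi).mono_measure
    (Measure.restrict_mono Ioc_subset_Ioi_self le_rfl)

/-- Integrals against a kernel dominated by `D (t-s)^(a-1)`. -/
lemma kernel_integral_bound {a t B M D : ℝ} {φ F κ : ℝ → ℝ}
    (hφ : IntegrableOn (fun s => (t - s) ^ (a - 1) * φ s) (Ioc 0 t))
    (hB : ∫ s in Ioc 0 t, (t - s) ^ (a - 1) * φ s ≤ B)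
    (hFc : ContinuousOn F (Ioi 0)) (hM : 0 ≤ M) (hD : 0 ≤ D)
    (hF : ∀ s ∈ Ioo 0 t, |F s| ≤ M * φ s) (hκm : Measurable κ)
    (hκ : ∀ s ∈ Ioo 0 t, |κ s| ≤ D * (t - s) ^ (a - 1)) :
    IntegrableOn (fun s => κ s * F s) (Ioc 0 t) ∧
      |∫ s in Ioc 0 t, κ s * F s| ≤ D * M * B := by
  have hbd : ∀ᵐ s ∂(volume.restrict (Ioc 0 t)),
      ‖κ s * F s‖ ≤ D * M * ((t - s) ^ (a - 1) * φ s) := by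
    filter_upwards [ae_restrict_Ioc_mem_Ioo t] with s hs
    rw [norm_mul, Real.norm_eq_abs, Real.norm_eq_abs]
    calc _ ≤ (D * (t - s) ^ (a - 1)) * (M * φ s) :=
          mul_le_mul (hκ s hs) (hF s hs) (abs_nonneg _) ((abs_nonneg _).trans (hκ s hs))
      _ = _ := by ring
  have hdom := hφ.const_mul (D * M)
  refine ⟨hdom.mono' (hκm.aestronglyMeasurable.mul
    (aestronglyMeasurable_Ioc_of_continuousOn hFc t)) hbd, ?_⟩
  rw [← Real.norm_eq_abs]
  refine (norm_integral_le_of_norm_le hdom hbd).trans ?_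
  rw [integral_const_mul]
  exact mul_le_mul_of_nonneg_left hB (by positivity)

lemma sub_rpow_le_mul_sub_rpow {β a s t : ℝ} (haβ : a ≤ β) (hst : s < t) {δ : ℝ}
    (hδ : t - s ≤ δ) : |(t - s) ^ (β - 1)| ≤ δ ^ (β - a) * (t - s) ^ (a - 1) := by
  have h : 0 < t - s := by linarith
  rw [abs_of_nonneg (by positivity), show β - 1 = (β - a) + (a - 1) by ring, rpow_add h]
  exact mul_le_mul_of_nonneg_right (rpow_le_rpow h.le hδ (by linarith)) (by positivity)

/-- With ρ = u/(u+δ) the increment is u^(β-1) (1 - ρ^(1-β)), and 1 - ρ^(1-β) ≤ 1 - ρ ≤ (δ/u)^(β-a).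
Thus an increment of the kernel costs δ^(β-a) times a kernel of order a. -/
lemma rpow_add_sub_rpow_abs_le {β a u δ : ℝ} (hβ1 : β < 1) (ha : 0 < a) (haβ : a < β) (hu : 0 < u)
    (hδ : 0 ≤ δ) :
    |(u + δ) ^ (β - 1) - u ^ (β - 1)| ≤ δ ^ (β - a) * u ^ (a - 1) := by
  have hud : 0 < u + δ := by linarith
  have h1 : (u + δ) ^ (β - 1) ≤ u ^ (β - 1) :=
    rpow_le_rpow_of_nonpos hu (by linarith) (by linarith)
  rw [abs_sub_comm, abs_of_nonneg (by linarith)]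
  set ρ := u / (u + δ) with hρ
  have hρ0 : 0 < ρ := by positivity
  have hρ1 : ρ ≤ 1 := (div_le_one hud).2 (by linarith)
  have e1 : (u + δ) ^ (β - 1) = u ^ (β - 1) * ρ ^ (1 - β) := by
    rw [hρ, div_rpow hu.le hud.le, show β - 1 = -(1 - β) by ring, rpow_neg hu.le,
      rpow_neg hud.le]
    have : 0 < u ^ (1 - β) := by positivity
    field_simp
  have h2 : ρ ≤ ρ ^ (1 - β) := by
    conv_lhs => rw [← rpow_one ρ]
    exact rpow_le_rpow_of_exponent_ge hρ0 hρ1 (by linarith)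
  have h3 : 1 - ρ ≤ (δ / u) ^ (β - a) := by
    have e2 : 1 - ρ = δ / (u + δ) := by rw [hρ]; field_simp; ring
    rcases hδ.eq_or_lt with h | h
    · rw [e2, ← h]; simp [zero_rpow (by linarith : β - a ≠ 0)]
    have z0 : 0 < 1 - ρ := by rw [e2]; positivity
    calc 1 - ρ = (1 - ρ) ^ (1 : ℝ) := (rpow_one _).symm
      _ ≤ (1 - ρ) ^ (β - a) := rpow_le_rpow_of_exponent_ge z0 (by linarith) (by linarith)
      _ ≤ _ := by
        refine rpow_le_rpow z0.le ?_ (by linarith)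
        rw [e2]
        exact div_le_div_of_nonneg_left hδ hu (by linarith)
  have e3 : u ^ (a - 1) = u ^ (β - 1) * (u ^ (β - a))⁻¹ := by
    rw [← rpow_neg hu.le, ← rpow_add hu]; congr 1; ring
  have h4 : (0 : ℝ) ≤ u ^ (β - 1) := by positivity
  calc u ^ (β - 1) - (u + δ) ^ (β - 1) = u ^ (β - 1) * (1 - ρ ^ (1 - β)) := by rw [e1]; ring
    _ ≤ u ^ (β - 1) * (δ / u) ^ (β - a) := mul_le_mul_of_nonneg_left (by linarith) h4
    _ = _ := by rw [e3, div_rpow hδ hu.le]; ring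

/-- The constant is chosen before `F` and `M`, so it serves whole families; t^(β-a) is the gain from
comparing order β with order a. -/
lemma AbelWeight.abelIntegral_bound {β a : ℝ} {φ : ℝ → ℝ} (haβ : a ≤ β) (hφ : AbelWeight β a φ)
    {T : ℝ} (hT : 0 < T) : ∃ C : ℝ, 0 ≤ C ∧ ∀ (F : ℝ → ℝ) (M : ℝ), ContinuousOn F (Ioi 0) → 0 ≤ M →
      (∀ s, 0 < s → s ≤ T → |F s| ≤ M * φ s) → ∀ t, 0 < t → t ≤ T →
      IntegrableOn (fun s => (t - s) ^ (β - 1) * F s) (Ioc 0 t) ∧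
      |abelIntegral β F t| ≤ t ^ (β - a) * M * (C * t ^ (β - 1)) := by
  obtain ⟨C, hC0, hC⟩ := hφ T hT
  refine ⟨C, hC0, fun F M hFc hM hF t ht htT => ?_⟩
  obtain ⟨i, b⟩ := hC t ht htT
  exact kernel_integral_bound i b hFc hM (by positivity)
    (fun s hs => hF s hs.1 (hs.2.le.trans htT)) (by fun_prop)
    (fun s hs => sub_rpow_le_mul_sub_rpow haβ hs.2 (by linarith [hs.1]))

/-- For a ≤ 1 the kernel (T-s)^(a-1) is bounded below by T^(a-1) on (0,T), so integrability against
it implies plain integrability. -/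
lemma AbelWeight.integrableOn {β a : ℝ} {φ F : ℝ → ℝ} (ha1 : a ≤ 1)
    (hφ : AbelWeight β a φ) {T M : ℝ} (hT : 0 < T) (hFc : ContinuousOn F (Ioi 0)) (hM : 0 ≤ M)
    (hF : ∀ s, 0 < s → s ≤ T → |F s| ≤ M * φ s) : IntegrableOn F (Ioc 0 T) := by
  obtain ⟨C, hC0, hC⟩ := hφ T hT
  obtain ⟨i, b⟩ := hC T hT le_rfl
  have := (kernel_integral_bound (κ := fun _ => 1) (D := T ^ (1 - a)) i b hFc hM (by positivity)
    (fun s hs => hF s hs.1 hs.2.le) (by fun_prop) (fun s hs => ?_)).1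
  · simpa using this
  · have h : 0 < T - s := by linarith [hs.2]
    rw [abs_one]
    calc (1 : ℝ) = (T - s) ^ (1 - a) * (T - s) ^ (a - 1) := by
          rw [← rpow_add h]; simp
      _ ≤ _ := mul_le_mul_of_nonneg_right
        (rpow_le_rpow h.le (by linarith [hs.1]) (by linarith)) (by positivity)

/-- The difference is the kernel increment over (0,t₁] plus the new piece over (t₁,t₂]. Both kernels
are at most (t₂-t₁)^(β-a) times an order-a kernel, singular at t₁ and at t₂ respectively. -/
lemma AbelWeight.abelIntegral_sub_le {β a : ℝ} {φ : ℝ → ℝ} (hβ1 : β < 1) (ha : 0 < a) (haβ : a < β)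
    (hφ : AbelWeight β a φ) {T : ℝ} (hT : 0 < T) :
    ∃ C : ℝ, 0 ≤ C ∧ ∀ (F : ℝ → ℝ) (M : ℝ), ContinuousOn F (Ioi 0) → 0 ≤ M →
      (∀ s, 0 < s → s ≤ T → |F s| ≤ M * φ s) → ∀ t₁ t₂, 0 < t₁ → t₁ ≤ t₂ → t₂ ≤ T →
      |abelIntegral β F t₂ - abelIntegral β F t₁| ≤ M * C * t₁ ^ (β - 1) * (t₂ - t₁) ^ (β - a) := by
  obtain ⟨C, hC0, hC⟩ := hφ T hT
  obtain ⟨C', hC0', hC'⟩ := hφ.abelIntegral_bound haβ.le hT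
  refine ⟨2 * C, by positivity, fun F M hFc hM hF t₁ t₂ h1 h12 h2 => ?_⟩
  obtain ⟨i1, b1⟩ := hC t₁ h1 (h12.trans h2)
  obtain ⟨i2, b2⟩ := hC t₂ (h1.trans_le h12) h2
  have j1 := (hC' F M hFc hM hF t₁ h1 (h12.trans h2)).1
  have j2 := (hC' F M hFc hM hF t₂ (h1.trans_le h12) h2).1
  have hδ : 0 ≤ (t₂ - t₁) ^ (β - a) := rpow_nonneg (by linarith) _
  have k1 := (kernel_integral_bound (κ := fun s => (t₂ - s) ^ (β - 1) - (t₁ - s) ^ (β - 1))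
    i1 b1 hFc hM hδ (fun s hs => hF s hs.1 (hs.2.le.trans (h12.trans h2)))
    (by fun_prop) (fun s hs => by
      have := rpow_add_sub_rpow_abs_le hβ1 ha haβ (u := t₁ - s) (δ := t₂ - t₁)
        (by linarith [hs.2]) (by linarith)
      rwa [show t₁ - s + (t₂ - t₁) = t₂ - s by ring] at this)).2
  have k2 := (kernel_integral_bound (κ := (Ioc t₁ t₂).indicator fun s => (t₂ - s) ^ (β - 1))
    i2 b2 hFc hM hδ (fun s hs => hF s hs.1 (hs.2.le.trans h2))
    (Measurable.indicator (by fun_prop) measurableSet_Ioc) (fun s hs => by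
      by_cases h : s ∈ Ioc t₁ t₂
      · rw [indicator_of_mem h]
        exact sub_rpow_le_mul_sub_rpow haβ.le hs.2 (by linarith [h.1])
      · rw [indicator_of_notMem h, abs_zero]
        have : 0 < t₂ - s := by linarith [hs.2]
        positivity)).2
  have e : abelIntegral β F t₂ - abelIntegral β F t₁ =
      (∫ s in Ioc 0 t₁, ((t₂ - s) ^ (β - 1) - (t₁ - s) ^ (β - 1)) * F s) +
      ∫ s in Ioc 0 t₂, (Ioc t₁ t₂).indicator (fun s => (t₂ - s) ^ (β - 1)) s * F s := by
    have j2a := j2.mono_set (Ioc_subset_Ioc_right h12)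
    have s1 : (∫ s in Ioc 0 t₁, ((t₂ - s) ^ (β - 1) - (t₁ - s) ^ (β - 1)) * F s) =
        (∫ s in Ioc 0 t₁, (t₂ - s) ^ (β - 1) * F s) - abelIntegral β F t₁ := by
      rw [abelIntegral, ← integral_sub j2a j1]
      simp only [sub_mul]
    have s2 : (∫ s in Ioc 0 t₂, (Ioc t₁ t₂).indicator (fun s => (t₂ - s) ^ (β - 1)) s * F s) =
        ∫ s in Ioc t₁ t₂, (t₂ - s) ^ (β - 1) * F s := by
      simp only [← indicator_mul_left]
      rw [setIntegral_indicator measurableSet_Ioc]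
      congr 2
      rw [inter_eq_right]
      exact Ioc_subset_Ioc_left h1.le
    have s3 : abelIntegral β F t₂ = (∫ s in Ioc 0 t₁, (t₂ - s) ^ (β - 1) * F s) +
        ∫ s in Ioc t₁ t₂, (t₂ - s) ^ (β - 1) * F s := by
      rw [abelIntegral, ← Ioc_union_Ioc_eq_Ioc h1.le h12]
      exact setIntegral_union (Ioc_disjoint_Ioc_of_le le_rfl) measurableSet_Ioc j2a
        (j2.mono_set (Ioc_subset_Ioc_left h1.le))
    rw [s1, s2, s3]; ring
  rw [e]
  refine (abs_add_le _ _).trans ((add_le_add k1 k2).trans ?_)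
  have h3 : t₂ ^ (β - 1) ≤ t₁ ^ (β - 1) := rpow_le_rpow_of_nonpos h1 h12 (by linarith)
  have : 0 ≤ (t₂ - t₁) ^ (β - a) * M * C := by positivity
  nlinarith

/-- Abel integrals of a family with a common dominating weight are equicontinuous. -/
lemma AbelWeight.equicontinuousAt {β a : ℝ} {φ : ℝ → ℝ} (hβ1 : β < 1) (ha : 0 < a) (haβ : a < β)
    (hφ : AbelWeight β a φ) {ι : Type*} {F : ι → ℝ → ℝ} (hFc : ∀ i, ContinuousOn (F i) (Ioi 0))
    (hF : ∀ T : ℝ, 0 < T → ∃ M : ℝ, 0 ≤ M ∧ ∀ i s, 0 < s → s ≤ T → |F i s| ≤ M * φ s)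
    {t₀ : ℝ} (ht₀ : 0 < t₀) : EquicontinuousAt (fun i t => abelIntegral β (F i) t) t₀ := by
  have hT : 0 < 2 * t₀ := by linarith
  obtain ⟨M, hM, hFM⟩ := hF _ hT
  obtain ⟨C, hC0, hC⟩ := hφ.abelIntegral_sub_le hβ1 ha haβ hT
  refine Metric.equicontinuousAt_of_continuity_modulus
    (fun t => M * C * (t₀ / 2) ^ (β - 1) * |t - t₀| ^ (β - a)) ?_ _ ?_
  · have : Tendsto (fun t : ℝ => |t - t₀| ^ (β - a)) (𝓝 t₀) (𝓝 0) := by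
      have h : ContinuousAt (fun t : ℝ => |t - t₀| ^ (β - a)) t₀ :=
        ContinuousAt.rpow_const (by fun_prop) (Or.inr (by linarith))
      have := h.tendsto
      simpa [zero_rpow (by linarith : β - a ≠ 0)] using this
    simpa using this.const_mul (M * C * (t₀ / 2) ^ (β - 1))
  · filter_upwards [Ioo_mem_nhds (by linarith : t₀ / 2 < t₀) (by linarith : t₀ < 2 * t₀)] with t ht i
    have mono : ∀ r, t₀ / 2 ≤ r → M * C * r ^ (β - 1) * |t - t₀| ^ (β - a) ≤
        M * C * (t₀ / 2) ^ (β - 1) * |t - t₀| ^ (β - a) := by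
      intro r hr
      have := rpow_le_rpow_of_nonpos (by linarith) hr (by linarith : β - 1 ≤ 0)
      gcongr
    rcases le_total t₀ t with h | h
    · have := hC (F i) M (hFc i) hM (hFM i) t₀ t ht₀ h ht.2.le
      rw [dist_comm, Real.dist_eq]
      refine this.trans ?_
      have h2 := mono t₀ (by linarith)
      rwa [abs_of_nonneg (by linarith : 0 ≤ t - t₀)] at h2 ⊢
    · have := hC (F i) M (hFc i) hM (hFM i) t t₀ (by linarith [ht.1]) h (by linarith)
      rw [Real.dist_eq]
      refine this.trans ?_
      have h2 := mono t ht.1.le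
      rwa [abs_of_nonpos (by linarith : t - t₀ ≤ 0), neg_sub] at h2 ⊢

lemma exp_neg_le_rpow_neg {ε z : ℝ} (hε : 0 ≤ ε) (hε1 : ε ≤ 1) (hz : 0 < z) :
    Real.exp (-z) ≤ z ^ (-ε) := by
  rw [Real.exp_neg, rpow_neg hz.le]
  refine inv_anti₀ (by positivity) ?_
  rcases le_total z 1 with h | h
  · exact (rpow_le_one hz.le h hε).trans (Real.one_le_exp hz.le)
  · calc z ^ ε ≤ z ^ (1 : ℝ) := rpow_le_rpow_of_exponent_le h hε1
      _ = z := rpow_one z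
      _ ≤ _ := by linarith [Real.add_one_le_exp z]

/-- Bielecki estimate: an exponential growth rate `l` gains a factor `l^(a-β)`. -/
lemma AbelWeight.exp_bound {β a : ℝ} {φ : ℝ → ℝ} (hβ1 : β < 1) (ha : 0 < a) (haβ : a < β)
    (hφ : AbelWeight β a φ) {T : ℝ} (hT : 0 < T) : ∃ C : ℝ, 0 ≤ C ∧ ∀ (F : ℝ → ℝ) (M l : ℝ),
      ContinuousOn F (Ioi 0) → 0 ≤ M → 0 < l →
      (∀ s, 0 < s → s ≤ T → |F s| ≤ M * Real.exp (l * s) * φ s) → ∀ t, 0 < t → t ≤ T →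
      |abelIntegral β F t| ≤ l ^ (a - β) * Real.exp (l * t) * M * (C * t ^ (β - 1)) := by
  obtain ⟨C, hC0, hC⟩ := hφ T hT
  refine ⟨C, hC0, fun F M l hFc hM hl hF t ht htT => ?_⟩
  obtain ⟨i, b⟩ := hC t ht htT
  -- The factor e^(ls) moves from `F` to the kernel. There e^(-l(t-s)) ≤ (l(t-s))^(a-β) produces
  -- l^(a-β), at the price of worsening the singularity from exponent β-1 to a-1.
  have := (kernel_integral_bound (F := fun s => Real.exp (-(l * s)) * F s)
    (κ := fun s => (t - s) ^ (β - 1) * Real.exp (l * s))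
    (D := l ^ (a - β) * Real.exp (l * t)) i b (by fun_prop) hM (by positivity)
    (fun s hs => ?_) (by fun_prop) (fun s hs => ?_)).2
  · convert! this using 3
    refine setIntegral_congr_fun measurableSet_Ioc fun s hs => ?_
    rw [Real.exp_neg]
    field_simp
  · rw [abs_mul, abs_of_pos (Real.exp_pos _)]
    have := mul_le_mul_of_nonneg_left (hF s hs.1 (hs.2.le.trans htT))
      (Real.exp_pos (-(l * s))).le
    refine this.trans (le_of_eq ?_)
    rw [Real.exp_neg]
    field_simp
  · have h : 0 < t - s := by linarith [hs.2]
    rw [abs_of_nonneg (by positivity)]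
    have e := exp_neg_le_rpow_neg (ε := β - a) (z := l * (t - s)) (by linarith) (by linarith)
      (by positivity)
    rw [neg_sub, mul_rpow hl.le h.le] at e
    have e2 : Real.exp (l * s) = Real.exp (-(l * (t - s))) * Real.exp (l * t) := by
      rw [← Real.exp_add]; congr 1; ring
    have e3 : (t - s) ^ (a - 1) = (t - s) ^ (β - 1) * (t - s) ^ (a - β) := by
      rw [← rpow_add h]; congr 1; ring
    rw [e2, e3]
    have h0 : 0 ≤ (t - s) ^ (β - 1) * Real.exp (l * t) := by positivity
    calc _ = (t - s) ^ (β - 1) * Real.exp (l * t) * Real.exp (-(l * (t - s))) := by ring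
      _ ≤ _ := mul_le_mul_of_nonneg_left e h0
      _ = _ := by ring

/-! ### The delayed Volterra equation -/

/-- The Volterra operator for the weighted unknown `y(t) = t^(1-β) x(t)`, with delay `δ`. -/
noncomputable def delayedVolterra (β x₀ : ℝ) (f : ℝ → ℝ → ℝ) (δ : ℝ) (y : ℝ → ℝ) (t : ℝ) : ℝ :=
  if t ≤ 0 then x₀ else
    x₀ + t ^ (1 - β) * (1 / Real.Gamma β *
      abelIntegral β (fun s => f s (s ^ (β - 1) * y (s - δ))) t)

/-- Continuity of `f` together with affine growth governed by the weight `φ`. -/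
structure WeightedAffineGrowth (β : ℝ) (f : ℝ → ℝ → ℝ) (φ : ℝ → ℝ) : Prop where
  continuousOn : ContinuousOn (fun q : ℝ × ℝ => f q.1 q.2) (Ioi 0 ×ˢ univ)
  bound : ∀ s v : ℝ, 0 < s → |f s (s ^ (β - 1) * v)| ≤ φ s * (1 + |v|)

section
variable {β a x₀ : ℝ} {f : ℝ → ℝ → ℝ} {φ : ℝ → ℝ}

lemma WeightedAffineGrowth.nonneg (hf : WeightedAffineGrowth β f φ) {s : ℝ} (hs : 0 < s) :
    0 ≤ φ s := by
  simpa using (abs_nonneg _).trans (hf.bound s 0 hs)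

lemma WeightedAffineGrowth.continuousOn_comp (hf : WeightedAffineGrowth β f φ) {x : ℝ → ℝ}
    (hx : ContinuousOn x (Ioi 0)) : ContinuousOn (fun s => f s (x s)) (Ioi 0) :=
  hf.continuousOn.comp (f := fun s => (s, x s)) (continuousOn_id.prodMk hx)
    fun _ hs => ⟨hs, mem_univ _⟩

lemma continuousOn_weighted_delay {y : ℝ → ℝ} (hy : Continuous y) (δ : ℝ) :
    ContinuousOn (fun s : ℝ => s ^ (β - 1) * y (s - δ)) (Ioi 0) := by
  refine ContinuousOn.mul (fun s hs => ?_) (by fun_prop)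
  exact (Real.continuousAt_rpow_const _ _ (Or.inl (ne_of_gt hs))).continuousWithinAt

/-- At 0 the distance to x₀ is O(t^(β-a)), because t^(1-β) cancels the t^(β-1) of the Abel bound.
For t > 0 this is equicontinuity of a one-member family. -/
lemma delayedVolterra_continuous (hβ : 0 < β) (hβ1 : β < 1) (ha : 0 < a) (haβ : a < β)
    (hf : WeightedAffineGrowth β f φ) (hφ : AbelWeight β a φ) (δ : ℝ) {y : ℝ → ℝ}
    (hy : Continuous y) : Continuous (delayedVolterra β x₀ f δ y) := by
  set F := fun s => f s (s ^ (β - 1) * y (s - δ)) with hFdef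
  have hFc : ContinuousOn F (Ioi 0) := hf.continuousOn_comp (continuousOn_weighted_delay hy δ)
  have hFb : ∀ T : ℝ, 0 < T → ∃ M : ℝ, 0 ≤ M ∧ ∀ s, 0 < s → s ≤ T → |F s| ≤ M * φ s := by
    intro T hT
    obtain ⟨B, hB⟩ := (isCompact_Icc (a := -δ) (b := T - δ)).exists_bound_of_continuousOn
      hy.continuousOn
    have hB0 : 0 ≤ B := (norm_nonneg _).trans (hB (-δ) ⟨le_rfl, by linarith⟩)
    refine ⟨1 + B, by positivity, fun s hs hsT => (hf.bound s _ hs).trans ?_⟩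
    rw [mul_comm]
    have := hB (s - δ) ⟨by linarith, by linarith⟩
    rw [Real.norm_eq_abs] at this
    exact mul_le_mul_of_nonneg_right (by linarith) (hf.nonneg hs)
  rw [continuous_iff_continuousAt]
  intro t
  rcases lt_trichotomy t 0 with ht | rfl | ht
  · refine (continuousAt_const (y := x₀)).congr ?_
    filter_upwards [Iio_mem_nhds ht] with s hs
    rw [delayedVolterra, if_pos (le_of_lt hs)]
  · obtain ⟨M, hM, hFM⟩ := hFb 1 one_pos
    obtain ⟨C, hC0, hC⟩ := hφ.abelIntegral_bound haβ.le one_pos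
    have hlim : Tendsto (fun t : ℝ => |1 / Real.Gamma β| * M * C * |t| ^ (β - a)) (𝓝 0) (𝓝 0) := by
      have h : ContinuousAt (fun t : ℝ => |t| ^ (β - a)) 0 :=
        ContinuousAt.rpow_const (by fun_prop) (Or.inr (by linarith))
      have := h.tendsto.const_mul (|1 / Real.Gamma β| * M * C)
      simpa [zero_rpow (by linarith : β - a ≠ 0)] using this
    have h0 : delayedVolterra β x₀ f δ y 0 = x₀ := by rw [delayedVolterra, if_pos le_rfl]
    rw [ContinuousAt, h0, tendsto_iff_dist_tendsto_zero]
    refine squeeze_zero' (Eventually.of_forall fun _ => dist_nonneg) ?_ hlim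
    filter_upwards [Iio_mem_nhds (zero_lt_one' ℝ)] with t ht
    by_cases h : t ≤ 0
    · rw [delayedVolterra, if_pos h, dist_self]; positivity
    · push Not at h
      rw [delayedVolterra, if_neg (not_le.2 h), Real.dist_eq, add_sub_cancel_left, abs_mul, abs_mul,
        abs_of_pos (by positivity : 0 < t ^ (1 - β)), abs_of_pos h]
      have := (hC F M hFc hM hFM t h (le_of_lt ht)).2
      have e : t ^ (1 - β) * t ^ (β - 1) = 1 := by rw [← rpow_add h]; simp
      calc _ ≤ t ^ (1 - β) * (|1 / Real.Gamma β| * (t ^ (β - a) * M * (C * t ^ (β - 1)))) := by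
            gcongr
        _ = |1 / Real.Gamma β| * M * C * t ^ (β - a) * (t ^ (1 - β) * t ^ (β - 1)) := by ring
        _ = _ := by rw [e, mul_one]
  · have hA : ContinuousAt (abelIntegral β F) t :=
      (hφ.equicontinuousAt hβ1 ha haβ (F := fun _ : Unit => F) (fun _ => hFc)
        (fun T hT => by
          obtain ⟨M, hM, h⟩ := hFb T hT
          exact ⟨M, hM, fun _ => h⟩) ht).continuousAt ()
    have h1 : ContinuousAt (fun t : ℝ => t ^ (1 - β)) t :=
      Real.continuousAt_rpow_const _ _ (Or.inl ht.ne')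
    refine ((continuousAt_const (y := x₀)).add (h1.mul (hA.const_mul (1 / Real.Gamma β)))).congr ?_
    filter_upwards [Ioi_mem_nhds ht] with s hs
    rw [delayedVolterra, if_neg (not_le.2 hs)]
    rfl

lemma delayedVolterra_congr {δ t : ℝ} {y z : ℝ → ℝ} (h : ∀ s ≤ t - δ, y s = z s) :
    delayedVolterra β x₀ f δ y t = delayedVolterra β x₀ f δ z t := by
  have : abelIntegral β (fun s => f s (s ^ (β - 1) * y (s - δ))) t =
      abelIntegral β (fun s => f s (s ^ (β - 1) * z (s - δ))) t := by
    refine setIntegral_congr_fun measurableSet_Ioc fun s hs => ?_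
    simp only [h (s - δ) (by linarith [hs.2])]
  rw [delayedVolterra, delayedVolterra, this]

/-- A bound on bounded intervals for the delayed iterates, uniform in the delay. -/
lemma delayedVolterra_iterate_bound (hβ : 0 < β) (hβ1 : β < 1) (ha : 0 < a) (haβ : a < β)
    (hf : WeightedAffineGrowth β f φ) (hφ : AbelWeight β a φ) {T : ℝ} (hT : 0 < T) :
    ∃ M : ℝ, 0 ≤ M ∧ ∀ δ : ℝ, 0 < δ → ∀ m : ℕ, ∀ t ≤ T,
      |(delayedVolterra β x₀ f δ)^[m] (fun _ => x₀) t| ≤ M := by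
  obtain ⟨C, hC0, hC⟩ := hφ.exp_bound hβ1 ha haβ hT
  set c := 1 / Real.Gamma β with hc
  have hc0 : 0 < c := one_div_pos.2 (Real.Gamma_pos_of_pos hβ)
  -- The exponential rate is so large that the Abel term contributes at most half of the bound.
  obtain ⟨l, hl0, hl⟩ : ∃ l : ℝ, 0 < l ∧ c * C * 2 * l ^ (a - β) ≤ 1 / 2 := by
    have h := (tendsto_rpow_neg_atTop (by linarith : 0 < β - a)).const_mul (c * C * 2)
    rw [mul_zero, neg_sub] at h
    obtain ⟨l, h1, h2⟩ := ((h.eventually_le_const (by norm_num : (0 : ℝ) < 1 / 2)).and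
      (eventually_gt_atTop 0)).exists
    exact ⟨l, h2, h1⟩
  -- M ≥ 1 gives 1 + |v| ≤ 2M e^(ls) whenever |v| ≤ M e^(ls), and |x₀| ≤ M/2 fills the other half of
  -- M e^(lt).
  set M := 1 + 2 * |x₀| with hM
  have hM1 : 1 ≤ M := by have := abs_nonneg x₀; linarith
  have hxM : |x₀| ≤ M := by have := abs_nonneg x₀; linarith
  have h1exp : ∀ t, 0 ≤ t → 1 ≤ Real.exp (l * t) := fun t ht => Real.one_le_exp (by positivity)
  refine ⟨M * Real.exp (l * T), by positivity, fun δ hδ m => ?_⟩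
  suffices h : Continuous ((delayedVolterra β x₀ f δ)^[m] (fun _ => x₀)) ∧
      ∀ t ≤ T, |(delayedVolterra β x₀ f δ)^[m] (fun _ => x₀) t| ≤ M * Real.exp (l * max t 0) by
    refine fun t ht => (h.2 t ht).trans ?_
    gcongr
    exact max_le ht hT.le
  induction m with
  | zero =>
    refine ⟨continuous_const, fun t ht => ?_⟩
    have := h1exp (max t 0) (le_max_right _ _)
    simp only [Function.iterate_zero, id]
    nlinarith
  | succ m ih =>
    rw [Function.iterate_succ_apply']
    obtain ⟨ihc, ihb⟩ := ih
    set y := (delayedVolterra β x₀ f δ)^[m] (fun _ => x₀)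
    refine ⟨delayedVolterra_continuous hβ hβ1 ha haβ hf hφ δ ihc, fun t ht => ?_⟩
    by_cases h : t ≤ 0
    · rw [delayedVolterra, if_pos h]
      have := h1exp (max t 0) (le_max_right _ _)
      nlinarith
    · push Not at h
      rw [delayedVolterra, if_neg (not_le.2 h), max_eq_left h.le]
      have hF := hC (fun s => f s (s ^ (β - 1) * y (s - δ))) (2 * M) l
        (hf.continuousOn_comp (continuousOn_weighted_delay ihc δ)) (by positivity) hl0
        (fun s hs hsT => by
          refine (hf.bound s _ hs).trans ?_
          rw [mul_comm]
          refine mul_le_mul_of_nonneg_right ?_ (hf.nonneg hs)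
          have h1 := ihb (s - δ) (by linarith)
          have h2 : Real.exp (l * max (s - δ) 0) ≤ Real.exp (l * s) := by
            gcongr
            exact max_le (by linarith) hs.le
          have h3 := h1exp s hs.le
          nlinarith) t h ht
      have e : t ^ (1 - β) * t ^ (β - 1) = 1 := by rw [← rpow_add h]; simp
      have hE := h1exp t h.le
      refine (abs_add_le _ _).trans ?_
      rw [abs_mul, abs_mul, abs_of_pos (by positivity : 0 < t ^ (1 - β)), abs_of_pos hc0]
      calc _ ≤ |x₀| + t ^ (1 - β) * (c * (l ^ (a - β) * Real.exp (l * t) * (2 * M) *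
            (C * t ^ (β - 1)))) := by gcongr
        _ = |x₀| + (c * C * 2 * l ^ (a - β)) * (M * Real.exp (l * t)) *
            (t ^ (1 - β) * t ^ (β - 1)) := by ring
        _ ≤ |x₀| + 1 / 2 * (M * Real.exp (l * t)) := by
            rw [e, mul_one]
            gcongr
        _ ≤ _ := by
            nlinarith

/-- Method of steps: every iterate equals x₀ for t ≤ 0, and since the operator sees its argument
only up to t - δ, each application extends the agreement by δ. -/
lemma delayedVolterra_iterate_succ {δ : ℝ} (m : ℕ) : ∀ t ≤ m * δ,
    (delayedVolterra β x₀ f δ)^[m + 1] (fun _ => x₀) t =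
      (delayedVolterra β x₀ f δ)^[m] (fun _ => x₀) t := by
  induction m with
  | zero =>
    intro t ht
    have : t ≤ 0 := by simpa using ht
    simp [delayedVolterra, this]
  | succ m ih =>
    intro t ht
    rw [Function.iterate_succ_apply', show (delayedVolterra β x₀ f δ)^[m + 1] (fun _ => x₀) t =
      delayedVolterra β x₀ f δ ((delayedVolterra β x₀ f δ)^[m] (fun _ => x₀)) t by
        rw [Function.iterate_succ_apply']]
    refine delayedVolterra_congr fun s hs => ih s ?_
    push_cast at ht
    linarith

lemma delayedVolterra_iterate_stable {δ : ℝ} (hδ : 0 < δ) {N m : ℕ} (hNm : N ≤ m) {t : ℝ}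
    (ht : t ≤ N * δ) : (delayedVolterra β x₀ f δ)^[m] (fun _ => x₀) t =
      (delayedVolterra β x₀ f δ)^[N] (fun _ => x₀) t := by
  induction m, hNm using Nat.le_induction with
  | base => rfl
  | succ m hm ih =>
    rw [delayedVolterra_iterate_succ m t, ih]
    exact ht.trans (by gcongr)

/-- The delayed equation has a solution, and it is bounded on bounded intervals uniformly in the
delay. -/
lemma exists_delayed_solution (hβ : 0 < β) (hβ1 : β < 1) (ha : 0 < a) (haβ : a < β)
    (hf : WeightedAffineGrowth β f φ) (hφ : AbelWeight β a φ) :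
    ∃ y : ℝ → ℝ → ℝ, (∀ δ, 0 < δ → Continuous (y δ) ∧ y δ = delayedVolterra β x₀ f δ (y δ)) ∧
      ∀ T : ℝ, 0 < T → ∃ M : ℝ, 0 ≤ M ∧ ∀ δ : ℝ, 0 < δ → ∀ t ≤ T, |y δ t| ≤ M := by
  set Y : ℝ → ℕ → ℝ → ℝ := fun δ m => (delayedVolterra β x₀ f δ)^[m] (fun _ => x₀) with hY
  -- At t the iterates are stationary from index ⌈t/δ⌉ on, so this is their eventual value.
  set y : ℝ → ℝ → ℝ := fun δ t => Y δ ⌈t / δ⌉₊ t with hy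
  have hyY : ∀ δ, 0 < δ → ∀ (N : ℕ) (t : ℝ), t ≤ N * δ → y δ t = Y δ N t := by
    intro δ hδ N t ht
    have h1 : t ≤ (⌈t / δ⌉₊ : ℝ) * δ := (div_le_iff₀ hδ).1 (Nat.le_ceil _)
    exact (delayedVolterra_iterate_stable hδ (le_max_left _ N) h1).symm.trans
      (delayedVolterra_iterate_stable hδ (le_max_right _ N) ht)
  have hYc : ∀ δ, ∀ m, Continuous (Y δ m) := by
    intro δ m
    induction m with
    | zero => exact continuous_const
    | succ m ih =>
      simp only [hY, Function.iterate_succ_apply']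
      exact delayedVolterra_continuous hβ hβ1 ha haβ hf hφ δ ih
  refine ⟨y, fun δ hδ => ⟨?_, ?_⟩, fun T hT => ?_⟩
  · rw [continuous_iff_continuousAt]
    intro t
    obtain ⟨N, hN⟩ := exists_nat_gt (t / δ)
    have hN' : t < N * δ := (div_lt_iff₀ hδ).1 hN
    refine (hYc δ N).continuousAt.congr ?_
    filter_upwards [Iio_mem_nhds hN'] with s hs using (hyY δ hδ N s (le_of_lt hs)).symm
  · ext t
    obtain ⟨N, hN⟩ := exists_nat_gt (t / δ)
    have hN' : t < N * δ := (div_lt_iff₀ hδ).1 hN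
    rw [delayedVolterra_congr (z := Y δ N) fun s hs => hyY δ hδ N s (by linarith),
      hyY δ hδ (N + 1) t (by push_cast; linarith)]
    simp only [hY, Function.iterate_succ_apply']
  · obtain ⟨M, hM, h⟩ := delayedVolterra_iterate_bound (x₀ := x₀) hβ hβ1 ha haβ hf hφ hT
    exact ⟨M, hM, fun δ hδ t ht => h δ hδ _ t ht⟩

end

/-! ### Compactness and removal of the delay -/

/-- A pointwise bounded, equicontinuous sequence on `(0,∞)` has a continuously convergent
subsequence. -/
lemma exists_subseq_of_equicontinuousAt {A : ℕ → ℝ → ℝ}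
    (heq : ∀ t, 0 < t → EquicontinuousAt A t) (hb : ∀ t, 0 < t → ∃ K : ℝ, ∀ n, |A n t| ≤ K) :
    ∃ (g : ℝ → ℝ) (ψ : ℕ → ℕ), StrictMono ψ ∧ ContinuousOn g (Ioi 0) ∧
      ∀ t, 0 < t → ∀ u : ℕ → ℝ, Tendsto u atTop (𝓝 t) →
        Tendsto (fun n => A (ψ n) (u n)) atTop (𝓝 (g t)) := by
  have hb' : ∀ q : ℚ, ∃ K : ℝ, ∀ n, 0 < (q : ℝ) → |A n q| ≤ K := by
    intro q
    by_cases hq : 0 < (q : ℝ)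
    · obtain ⟨K, hK⟩ := hb q hq
      exact ⟨K, fun n _ => hK n⟩
    · exact ⟨0, fun n h => absurd h hq⟩
  choose K hK using hb'
  -- A countable product of compact intervals replaces the diagonal argument over the positive
  -- rationals; the other rationals carry the dummy value 0.
  have hcomp : IsCompact (Set.pi univ fun q : ℚ => Icc (-|K q|) |K q|) :=
    isCompact_univ_pi fun q => isCompact_Icc
  obtain ⟨G, -, ψ, hψ, hG⟩ := hcomp.tendsto_subseq
    (x := fun n (q : ℚ) => if 0 < (q : ℝ) then A n q else 0) (fun n q _ => by
      by_cases hq : 0 < (q : ℝ)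
      · simp only [hq, if_true]
        exact abs_le.1 ((hK q n hq).trans (le_abs_self _))
      · simp [hq])
  rw [tendsto_pi_nhds] at hG
  have hq : ∀ q : ℚ, 0 < (q : ℝ) → Tendsto (fun n => A (ψ n) q) atTop (𝓝 (G q)) := by
    intro q h
    simpa [Function.comp_def, Rat.cast_pos.1 h] using hG q
  have hlim : ∀ t, 0 < t → ∃ L, Tendsto (fun n => A (ψ n) t) atTop (𝓝 L) := by
    intro t ht
    refine cauchySeq_tendsto_of_complete (Metric.cauchySeq_iff'.2 fun ε hε => ?_)
    obtain ⟨δ, hδ, hd⟩ := Metric.equicontinuousAt_iff.1 (heq t ht) (ε / 4) (by linarith)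
    obtain ⟨q, h1, h2⟩ := exists_rat_btwn (lt_add_of_pos_right t hδ)
    have hqt : dist (q : ℝ) t < δ := by
      rw [Real.dist_eq, abs_of_pos (by linarith)]; linarith
    obtain ⟨N, hN⟩ := Metric.cauchySeq_iff'.1 (hq q (ht.trans h1)).cauchySeq (ε / 4) (by linarith)
    refine ⟨N, fun n hn => ?_⟩
    have d1 := hd q hqt (ψ n)
    have d2 := hd q hqt (ψ N)
    have d3 := hN n hn
    rw [Real.dist_eq, abs_lt] at *
    constructor <;> linarith [d1.1, d1.2, d2.1, d2.2, d3.1, d3.2]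
  choose! g hg using hlim
  -- Moving arguments are needed because the delayed solutions are evaluated at s - d n.
  have hu : ∀ t, 0 < t → ∀ u : ℕ → ℝ, Tendsto u atTop (𝓝 t) →
      Tendsto (fun n => A (ψ n) (u n)) atTop (𝓝 (g t)) := by
    intro t ht u hu
    have hdist : Tendsto (fun n => dist (A (ψ n) (u n)) (A (ψ n) t)) atTop (𝓝 0) := by
      rw [Metric.tendsto_atTop]
      intro ε hε
      obtain ⟨δ, hδ, hd⟩ := Metric.equicontinuousAt_iff.1 (heq t ht) ε hε
      obtain ⟨N, hN⟩ := Metric.tendsto_atTop.1 hu δ hδ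
      refine ⟨N, fun n hn => ?_⟩
      rw [Real.dist_eq, sub_zero, abs_of_nonneg dist_nonneg, dist_comm]
      exact hd _ (hN n hn) _
    exact (tendsto_iff_of_dist hdist).2 (hg t ht)
  refine ⟨g, ψ, hψ, fun t ht => ?_, hu⟩
  refine ContinuousAt.continuousWithinAt (Metric.continuousAt_iff.2 fun ε hε => ?_)
  obtain ⟨δ, hδ, hd⟩ := Metric.equicontinuousAt_iff.1 (heq t ht) (ε / 2) (by linarith)
  have ht' : 0 < t := ht
  refine ⟨min δ t, lt_min hδ ht', fun s hs => ?_⟩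
  have hs0 : 0 < s := by
    have := hs.trans_le (min_le_right _ _)
    rw [Real.dist_eq, abs_lt] at this
    linarith [this.1]
  have hle : dist (g t) (g s) ≤ ε / 2 :=
    le_of_tendsto ((hg t ht).dist (hg s hs0))
      (Eventually.of_forall fun n => (hd s (hs.trans_le (min_le_left _ _)) _).le)
  rw [dist_comm]
  linarith

/-- Global solvability of the singular Volterra equation
`x(t) = x₀ t^(β-1) + (1/Γ(β)) ∫₀ᵗ (t-s)^(β-1) f(s, x(s)) ds`. -/
theorem exists_volterra_solution {β a : ℝ} {f : ℝ → ℝ → ℝ} {φ : ℝ → ℝ} (x₀ : ℝ) (hβ : 0 < β)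
    (hβ1 : β < 1) (ha : 0 < a) (haβ : a < β)
    (hf : WeightedAffineGrowth β f φ) (hφ : AbelWeight β a φ) :
    ∃ x : ℝ → ℝ, ContinuousOn x (Ioi 0) ∧
      (∀ T : ℝ, 0 < T → ∃ M : ℝ, 0 ≤ M ∧ ∀ s, 0 < s → s ≤ T →
        |x s| ≤ M * s ^ (β - 1) ∧ |f s (x s)| ≤ M * φ s) ∧
      ∀ t, 0 < t → x t = x₀ * t ^ (β - 1) +
        1 / Real.Gamma β * abelIntegral β (fun s => f s (x s)) t := by
  obtain ⟨y, hy, hyb⟩ := exists_delayed_solution (x₀ := x₀) hβ hβ1 ha haβ hf hφ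
  set c := 1 / Real.Gamma β with hc
  set d : ℕ → ℝ := fun n => 1 / ((n : ℝ) + 1) with hd
  have hd0 : ∀ n, 0 < d n := fun n => Nat.one_div_pos_of_nat
  have hdlim : Tendsto d atTop (𝓝 0) := tendsto_one_div_add_atTop_nhds_zero_nat
  set F : ℕ → ℝ → ℝ := fun n s => f s (s ^ (β - 1) * y (d n) (s - d n)) with hF
  have hFc : ∀ n, ContinuousOn (F n) (Ioi 0) := fun n =>
    hf.continuousOn_comp (continuousOn_weighted_delay (hy _ (hd0 n)).1 _)
  have hFb : ∀ T : ℝ, 0 < T → ∃ M : ℝ, 0 ≤ M ∧ ∀ n s, 0 < s → s ≤ T → |F n s| ≤ M * φ s := by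
    intro T hT
    obtain ⟨B, hB0, hB⟩ := hyb T hT
    refine ⟨1 + B, by positivity, fun n s hs hsT => (hf.bound s _ hs).trans ?_⟩
    rw [mul_comm]
    have := hB (d n) (hd0 n) (s - d n) (by linarith [hd0 n])
    exact mul_le_mul_of_nonneg_right (by linarith) (hf.nonneg hs)
  have hyA : ∀ n t, 0 < t → y (d n) t = x₀ + t ^ (1 - β) * (c * abelIntegral β (F n) t) := by
    intro n t ht
    rw [(hy _ (hd0 n)).2, delayedVolterra, if_neg (not_le.2 ht)]
  obtain ⟨g, ψ, hψ, hgc, hg⟩ := exists_subseq_of_equicontinuousAt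
    (A := fun n => abelIntegral β (F n))
    (fun t ht => hφ.equicontinuousAt hβ1 ha haβ hFc hFb ht)
    (fun t ht => by
      obtain ⟨M, hM, hFM⟩ := hFb t ht
      obtain ⟨C, hC0, hC⟩ := hφ.abelIntegral_bound haβ.le ht
      exact ⟨_, fun n => (hC (F n) M (hFc n) hM (hFM n) t ht le_rfl).2⟩)
  set x : ℝ → ℝ := fun t => t ^ (β - 1) * (x₀ + t ^ (1 - β) * (c * g t)) with hx
  have hrp : ∀ r : ℝ, ContinuousOn (fun t : ℝ => t ^ r) (Ioi 0) := fun r s hs =>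
    (Real.continuousAt_rpow_const _ _ (Or.inl (ne_of_gt hs))).continuousWithinAt
  have hxc : ContinuousOn x (Ioi 0) :=
    (hrp _).mul (continuousOn_const.add ((hrp _).mul (continuousOn_const.mul hgc)))
  have hyx : ∀ t, 0 < t → ∀ u : ℕ → ℝ, Tendsto u atTop (𝓝 t) →
      Tendsto (fun n => y (d (ψ n)) (u n)) atTop (𝓝 (x₀ + t ^ (1 - β) * (c * g t))) := by
    intro t ht u hu
    have h1 : Tendsto (fun n => x₀ + (u n) ^ (1 - β) * (c * abelIntegral β (F (ψ n)) (u n))) atTop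
        (𝓝 (x₀ + t ^ (1 - β) * (c * g t))) :=
      ((hu.rpow_const (Or.inl ht.ne')).mul ((hg t ht u hu).const_mul c)).const_add x₀
    refine h1.congr' ?_
    filter_upwards [hu.eventually (eventually_gt_nhds ht)] with n hn using (hyA _ _ hn).symm
  have hFlim : ∀ s, 0 < s → Tendsto (fun n => F (ψ n) s) atTop (𝓝 (f s (x s))) := by
    intro s hs
    have h1 : Tendsto (fun n => s - d (ψ n)) atTop (𝓝 s) := by
      simpa using (hdlim.comp hψ.tendsto_atTop).const_sub s
    have h2 : Tendsto (fun n => (s, s ^ (β - 1) * y (d (ψ n)) (s - d (ψ n)))) atTop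
        (𝓝 (s, x s)) := tendsto_const_nhds.prodMk_nhds ((hyx s hs _ h1).const_mul _)
    have h3 : ContinuousAt (fun q : ℝ × ℝ => f q.1 q.2) (s, x s) :=
      hf.continuousOn.continuousAt (prod_mem_nhds (Ioi_mem_nhds hs) univ_mem)
    exact h3.tendsto.comp h2
  have hfx : ∀ T : ℝ, 0 < T → ∃ M : ℝ, 0 ≤ M ∧ ∀ s, 0 < s → s ≤ T → |f s (x s)| ≤ M * φ s := by
    intro T hT
    obtain ⟨M, hM, h⟩ := hFb T hT
    exact ⟨M, hM, fun s hs hsT => le_of_tendsto (hFlim s hs).abs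
      (Eventually.of_forall fun n => h _ s hs hsT)⟩
  refine ⟨x, hxc, fun T hT => ?_, fun t ht => ?_⟩
  · obtain ⟨M, hM, h⟩ := hfx T hT
    obtain ⟨B, hB, hB'⟩ := hyb T hT
    refine ⟨max M B, le_max_of_le_left hM, fun s hs hsT => ⟨?_, (h s hs hsT).trans
      (mul_le_mul_of_nonneg_right (le_max_left _ _) (hf.nonneg hs))⟩⟩
    have hle : |x₀ + s ^ (1 - β) * (c * g s)| ≤ B :=
      le_of_tendsto (hyx s hs _ tendsto_const_nhds).abs
        (Eventually.of_forall fun n => hB' _ (hd0 _) s hsT)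
    have hp : 0 ≤ s ^ (β - 1) := by positivity
    rw [hx, abs_mul, abs_of_nonneg hp, mul_comm]
    exact mul_le_mul_of_nonneg_right (hle.trans (le_max_right _ _)) hp
  -- Dominated convergence, with a multiple of the order-a integrand of φ as majorant, moves the
  -- limit inside the Abel integral.
  · have hgt : g t = abelIntegral β (fun s => f s (x s)) t := by
      refine tendsto_nhds_unique (hg t ht _ tendsto_const_nhds) ?_
      obtain ⟨M, hM, h⟩ := hFb t ht
      obtain ⟨C, hC0, hC⟩ := hφ t ht
      refine tendsto_integral_of_dominated_convergence
        (fun s => t ^ (β - a) * M * ((t - s) ^ (a - 1) * φ s)) (fun n => ?_)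
        ((hC t ht le_rfl).1.const_mul _) (fun n => ?_) ?_
      · have m : Measurable fun s : ℝ => (t - s) ^ (β - 1) := by fun_prop
        exact m.aestronglyMeasurable.mul (aestronglyMeasurable_Ioc_of_continuousOn (hFc _) t)
      · filter_upwards [ae_restrict_Ioc_mem_Ioo t] with s hs
        have k := sub_rpow_le_mul_sub_rpow haβ.le hs.2 (by linarith [hs.1] : t - s ≤ t)
        rw [norm_mul, Real.norm_eq_abs, Real.norm_eq_abs]
        calc _ ≤ (t ^ (β - a) * (t - s) ^ (a - 1)) * (M * φ s) :=
              mul_le_mul k (h _ s hs.1 hs.2.le) (abs_nonneg _) ((abs_nonneg _).trans k)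
          _ = _ := by ring
      · filter_upwards [ae_restrict_Ioc_mem_Ioo t] with s hs using (hFlim s hs.1).const_mul _
    have e : t ^ (β - 1) * t ^ (1 - β) = 1 := by rw [← rpow_add ht]; simp
    rw [← hgt, hx]
    simp only
    linear_combination c * g t * e

/-! ### The Beta integral and the Riemann–Liouville derivative -/

/-- This is B(β, 1-β) rescaled to (0,t); the exponents add up to -1, so no power of t appears. -/
lemma beta_integral_one_sub {β t : ℝ} (hβ : 0 < β) (hβ1 : β < 1) (ht : 0 < t) :
    ∫ s in Ioc 0 t, s ^ (β - 1) * (t - s) ^ (-β) = Real.Gamma β * Real.Gamma (1 - β) := by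
  have h := Complex.betaIntegral_scaled (β : ℂ) ((1 - β : ℝ) : ℂ) ht
  have hG := Complex.Gamma_mul_Gamma_eq_betaIntegral (s := (β : ℂ)) (t := ((1 - β : ℝ) : ℂ))
    (by simpa using hβ) (by simpa using hβ1)
  have e : (β : ℂ) + ((1 - β : ℝ) : ℂ) = 1 := by push_cast; ring
  rw [e, Complex.Gamma_one, one_mul, Complex.Gamma_ofReal, Complex.Gamma_ofReal] at hG
  rw [e, sub_self, Complex.cpow_zero, one_mul, ← hG] at h
  rw [← intervalIntegral.integral_of_le ht.le]
  have h2 : ((∫ s in (0 : ℝ)..t, s ^ (β - 1) * (t - s) ^ (-β) : ℝ) : ℂ) =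
      ((Real.Gamma β * Real.Gamma (1 - β) : ℝ) : ℂ) := by
    rw [← intervalIntegral.integral_ofReal]
    push_cast at h ⊢
    rw [← h]
    refine intervalIntegral.integral_congr fun s hs => ?_
    rw [uIcc_of_le ht.le] at hs
    rw [Complex.ofReal_cpow hs.1, Complex.ofReal_cpow (by linarith [hs.2])]
    push_cast
    congr 2
    ring
  exact_mod_cast h2

lemma Gamma_mul_Gamma_one_sub_pos {β : ℝ} (hβ : 0 < β) (hβ1 : β < 1) :
    0 < Real.Gamma β * Real.Gamma (1 - β) :=
  mul_pos (Real.Gamma_pos_of_pos hβ) (Real.Gamma_pos_of_pos (by linarith))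

/-- A non-integrable function has integral 0 by convention, while this integral is positive. -/
lemma integrableOn_beta_one_sub {β t : ℝ} (hβ : 0 < β) (hβ1 : β < 1) (ht : 0 < t) :
    IntegrableOn (fun s => s ^ (β - 1) * (t - s) ^ (-β)) (Ioc 0 t) := by
  by_contra h
  have := beta_integral_one_sub hβ hβ1 ht
  rw [integral_undef h] at this
  exact (Gamma_mul_Gamma_one_sub_pos hβ hβ1).ne this

lemma beta_integral_one_sub_translate {β s t : ℝ} (hβ : 0 < β) (hβ1 : β < 1) (hst : s < t) :
    ∫ r in Ioc s t, (t - r) ^ (-β) * (r - s) ^ (β - 1) =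
      Real.Gamma β * Real.Gamma (1 - β) := by
  have h := intervalIntegral.integral_comp_sub_right (a := s) (b := t)
    (fun w => w ^ (β - 1) * ((t - s) - w) ^ (-β)) s
  rw [sub_self, intervalIntegral.integral_of_le hst.le,
    intervalIntegral.integral_of_le (by linarith : (0 : ℝ) ≤ t - s),
    beta_integral_one_sub hβ hβ1 (by linarith)] at h
  rw [← h]
  refine setIntegral_congr_fun measurableSet_Ioc fun r _ => ?_
  rw [mul_comm]
  congr 2
  ring

/-- Semigroup law `I^(1-β) I^β = I^1`, in unnormalised form. -/
lemma abelIntegral_abelIntegral {β t : ℝ} {F : ℝ → ℝ} (hβ : 0 < β) (hβ1 : β < 1)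
    (hF : IntegrableOn F (Ioc 0 t)) :
    IntegrableOn (fun r => (t - r) ^ (-β) * abelIntegral β F r) (Ioc 0 t) ∧
    ∫ r in Ioc 0 t, (t - r) ^ (-β) * abelIntegral β F r =
      Real.Gamma β * Real.Gamma (1 - β) * ∫ s in Ioc 0 t, F s := by
  set B := Real.Gamma β * Real.Gamma (1 - β) with hB
  have hB0 : 0 < B := Gamma_mul_Gamma_one_sub_pos hβ hβ1
  set ν := volume.restrict (Ioc (0 : ℝ) t) with hν
  -- Extending the kernel by 0 to r ≤ s lets both integrations run over all of (0,t], as Fubini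
  -- requires.
  set K : ℝ → ℝ → ℝ := fun r s =>
    (Ioi s).indicator (fun r => (t - r) ^ (-β) * (r - s) ^ (β - 1)) r with hK
  have hKm : Measurable (Function.uncurry K) := by
    have : Function.uncurry K = {q : ℝ × ℝ | q.2 < q.1}.indicator
        (fun q => (t - q.1) ^ (-β) * (q.1 - q.2) ^ (β - 1)) := by
      ext ⟨r, s⟩
      simp [hK, Function.uncurry, indicator]
    rw [this]
    exact Measurable.indicator (by fun_prop) (measurableSet_lt measurable_snd measurable_fst)
  have hKint : ∀ s ∈ Ioo 0 t, ∫ r, K r s ∂ν = B := by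
    intro s hs
    rw [hν, setIntegral_indicator measurableSet_Ioi, hB,
      ← beta_integral_one_sub_translate hβ hβ1 hs.2]
    congr 2
    ext r
    simp only [mem_inter_iff, mem_Ioc, mem_Ioi]
    exact ⟨fun h => ⟨h.2, h.1.2⟩, fun h => ⟨⟨hs.1.trans h.1, h.2⟩, h.1⟩⟩
  have hKi : ∀ s ∈ Ioo 0 t, Integrable (fun r => K r s) ν := by
    intro s hs
    by_contra h
    have := hKint s hs
    rw [integral_undef h] at this
    exact hB0.ne this
  have hKnn : ∀ s, ∀ r ∈ Ioc 0 t, 0 ≤ K r s := by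
    intro s r hr
    refine indicator_apply_nonneg fun hrs => ?_
    exact mul_nonneg (rpow_nonneg (by linarith [hr.2]) _)
      (rpow_nonneg (by linarith [mem_Ioi.1 hrs]) _)
  have hae : ∀ᵐ s ∂ν, s ∈ Ioo 0 t := ae_restrict_Ioc_mem_Ioo t
  have hint : Integrable (Function.uncurry fun r s => K r s * F s) (ν.prod ν) := by
    have hm : AEStronglyMeasurable (Function.uncurry fun r s => K r s * F s) (ν.prod ν) :=
      hKm.aestronglyMeasurable.mul hF.1.comp_snd
    -- By Tonelli: for almost every s the r-integral of the norm is B |F(s)|, which is integrable in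
    -- s.
    rw [integrable_prod_iff' hm]
    constructor
    · filter_upwards [hae] with s hs using (hKi s hs).mul_const (F s)
    · refine (hF.norm.const_mul B).congr ?_
      filter_upwards [hae] with s hs
      simp only [Function.uncurry, norm_mul]
      rw [integral_mul_const, ← hKint s hs]
      congr 1
      refine setIntegral_congr_fun measurableSet_Ioc fun r hr => ?_
      exact (Real.norm_of_nonneg (hKnn s r hr)).symm
  have hinner : ∀ r ∈ Ioc 0 t, ∫ s, K r s * F s ∂ν = (t - r) ^ (-β) * abelIntegral β F r := by
    intro r hr
    have e1 : ∀ s, K r s * F s =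
        (Iio r).indicator (fun s => (t - r) ^ (-β) * ((r - s) ^ (β - 1) * F s)) s := by
      intro s
      by_cases h : s < r
      · simp [hK, indicator, h, mul_assoc]
      · simp [hK, indicator, h]
    simp only [e1]
    rw [hν, setIntegral_indicator measurableSet_Iio, integral_const_mul, abelIntegral,
      integral_Ioc_eq_integral_Ioo]
    congr 3
    ext s
    simp only [mem_inter_iff, mem_Ioc, mem_Iio, mem_Ioo]
    exact ⟨fun h => ⟨h.1.1, h.2⟩, fun h => ⟨⟨h.1, h.2.le.trans hr.2⟩, h.2⟩⟩
  have hcongr : (fun r => ∫ s, K r s * F s ∂ν) =ᵐ[ν]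
      fun r => (t - r) ^ (-β) * abelIntegral β F r := by
    filter_upwards [ae_restrict_mem measurableSet_Ioc] with r hr using hinner r hr
  refine ⟨hint.integral_prod_left.congr hcongr, ?_⟩
  rw [← integral_congr_ae hcongr, integral_integral_swap hint, ← integral_const_mul]
  refine integral_congr_ae ?_
  filter_upwards [hae] with s hs
  rw [integral_mul_const, hKint s hs]

/-- A solution of the Volterra equation has the expected Riemann-Liouville derivative. -/
theorem hasRLDeriv_of_volterra {β x₀ : ℝ} {x F : ℝ → ℝ} (hβ : 0 < β) (hβ1 : β < 1)
    (hFc : ContinuousOn F (Ioi 0)) (hFi : ∀ T : ℝ, 0 < T → IntegrableOn F (Ioc 0 T))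
    (hxi : ∀ T : ℝ, 0 < T → IntegrableOn x (Ioc 0 T))
    (hx : ∀ t, 0 < t → x t = x₀ * t ^ (β - 1) + 1 / Real.Gamma β * abelIntegral β F t) :
    HasRLDeriv β x F := by
  have hG := Real.Gamma_pos_of_pos hβ
  have hG' := Real.Gamma_pos_of_pos (by linarith : 0 < 1 - β)
  have key : ∀ t, 0 < t → rlIntegral (1 - β) x t = x₀ * Real.Gamma β + ∫ s in (0 : ℝ)..t, F s := by
    intro t ht
    obtain ⟨i1, e1⟩ := abelIntegral_abelIntegral hβ hβ1 (hFi t ht)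
    have i2 := integrableOn_beta_one_sub hβ hβ1 ht
    have e : abelIntegral (1 - β) x t = ∫ r in Ioc 0 t, (x₀ * (r ^ (β - 1) * (t - r) ^ (-β)) +
        1 / Real.Gamma β * ((t - r) ^ (-β) * abelIntegral β F r)) := by
      refine setIntegral_congr_fun measurableSet_Ioc fun r hr => ?_
      rw [hx r hr.1, show 1 - β - 1 = -β by ring]
      ring
    rw [rlIntegral_eq_abelIntegral _ _ ht.le, e, integral_add (i2.const_mul _) (i1.const_mul _),
      integral_const_mul, integral_const_mul, e1, beta_integral_one_sub hβ hβ1 ht,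
      intervalIntegral.integral_of_le ht.le]
    field_simp
  have hFii : ∀ T : ℝ, 0 < T → IntervalIntegrable F volume 0 T := fun T hT =>
    (intervalIntegrable_iff_integrableOn_Ioc_of_le hT.le).2 (hFi T hT)
  -- The absolutely continuous representative takes the limit value x₀ Γ(β) at 0, where `rlIntegral`
  -- itself evaluates to 0.
  refine ⟨fun T hT => (intervalIntegrable_iff_integrableOn_Ioc_of_le hT.le).2 (hxi T hT),
    fun T hT => ⟨fun t => x₀ * Real.Gamma β + ∫ s in (0 : ℝ)..t, F s, ?_, fun t ht => key t ht.1⟩,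
    fun t ht => ?_⟩
  · have h1 : AbsolutelyContinuousOnInterval (fun _ : ℝ => x₀ * Real.Gamma β) 0 T :=
      ((LipschitzWith.const (x₀ * Real.Gamma β)).lipschitzOnWith
        (s := uIcc 0 T)).absolutelyContinuousOnInterval
    exact h1.add ((hFii T hT).absolutelyContinuousOnInterval_intervalIntegral left_mem_uIcc)
  · have hd : HasDerivAt (fun t => x₀ * Real.Gamma β + ∫ s in (0 : ℝ)..t, F s) (F t) t :=
      (intervalIntegral.integral_hasDerivAt_right (hFii t ht)
        (hFc.stronglyMeasurableAtFilter isOpen_Ioi t ht)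
        (hFc.continuousAt (Ioi_mem_nhds ht))).const_add _
    refine hd.congr_of_eventuallyEq ?_
    filter_upwards [Ioi_mem_nhds ht] with s hs using key s hs

/-! ### Boundedness and limits at infinity -/

lemma beta_integral_one_sub_symm {β t : ℝ} (hβ : 0 < β) (hβ1 : β < 1) (ht : 0 < t) :
    IntegrableOn (fun s => (t - s) ^ (β - 1) * s ^ (-β)) (Ioc 0 t) ∧
    ∫ s in Ioc 0 t, (t - s) ^ (β - 1) * s ^ (-β) = Real.Gamma β * Real.Gamma (1 - β) := by
  have i := integrableOn_beta_one_sub (β := 1 - β) (by linarith) (by linarith) ht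
  have e := beta_integral_one_sub (β := 1 - β) (by linarith) (by linarith) ht
  simp only [sub_sub_cancel_left, neg_sub, sub_sub_cancel] at i e
  exact ⟨by simpa only [mul_comm] using i, by simpa only [mul_comm] using e⟩

/-- Splitting estimate for the Abel integral of a function that is `O(s^(-β))` beyond `T₀`. -/
lemma abs_abelIntegral_le {β T₀ t η : ℝ} {E : ℝ → ℝ} (hβ : 0 < β) (hβ1 : β < 1) (hT₀ : 0 < T₀)
    (ht : T₀ < t) (hη : 0 ≤ η) (hE : IntegrableOn E (Ioc 0 T₀))
    (hEb : ∀ s, T₀ < s → s ≤ t → |E s| ≤ η * s ^ (-β)) :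
    |abelIntegral β E t| ≤ (t - T₀) ^ (β - 1) * (∫ s in Ioc 0 T₀, |E s|) +
      η * (Real.Gamma β * Real.Gamma (1 - β)) := by
  obtain ⟨i, e⟩ := beta_integral_one_sub_symm hβ hβ1 (hT₀.trans ht)
  have hsub : Ioc 0 t ∩ Ioc 0 T₀ = Ioc 0 T₀ := inter_eq_right.2 (Ioc_subset_Ioc_right ht.le)
  have i1 : IntegrableOn ((Ioc 0 T₀).indicator fun s => |E s|) (Ioc 0 t) := by
    have := (integrable_indicator_iff measurableSet_Ioc).2 hE.norm
    exact this.integrableOn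
  have hdom := (i1.const_mul ((t - T₀) ^ (β - 1))).add (i.const_mul η)
  rw [abelIntegral, ← Real.norm_eq_abs]
  refine (norm_integral_le_of_norm_le hdom ?_).trans (le_of_eq ?_)
  · filter_upwards [ae_restrict_Ioc_mem_Ioo t] with s hs
    have hts : 0 < t - s := by linarith [hs.2]
    have hs0 := hs.1
    rw [norm_mul, Real.norm_of_nonneg (by positivity), Real.norm_eq_abs]
    have htT : 0 ≤ (t - T₀) ^ (β - 1) := rpow_nonneg (by linarith) _
    simp only [Pi.add_apply]
    by_cases h : s ≤ T₀
    · rw [indicator_of_mem (show s ∈ Ioc 0 T₀ from ⟨hs0, h⟩)]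
      have h1 : (t - s) ^ (β - 1) ≤ (t - T₀) ^ (β - 1) :=
        rpow_le_rpow_of_nonpos (by linarith) (by linarith) (by linarith)
      have h2 : 0 ≤ η * ((t - s) ^ (β - 1) * s ^ (-β)) := by positivity
      linarith [mul_le_mul_of_nonneg_right h1 (abs_nonneg (E s))]
    · push Not at h
      rw [indicator_of_notMem (fun h' => absurd h'.2 (not_le.2 h)), mul_zero, zero_add]
      calc _ ≤ (t - s) ^ (β - 1) * (η * s ^ (-β)) :=
            mul_le_mul_of_nonneg_left (hEb s h hs.2.le) (by positivity)
        _ = _ := by ring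
  · have e1 := integral_add (i1.const_mul ((t - T₀) ^ (β - 1))) (i.const_mul η)
    simp only [Pi.add_apply]
    rw [e1, integral_const_mul, integral_const_mul, e, setIntegral_indicator measurableSet_Ioc,
      hsub]

/-- If `t^β F(t) → b` then the Abel integral of order `β` of `F` tends to `b Γ(β) Γ(1-β)`. -/
lemma tendsto_abelIntegral_atTop {β b : ℝ} {F : ℝ → ℝ} (hβ : 0 < β) (hβ1 : β < 1)
    (hFi : ∀ T : ℝ, 0 < T → IntegrableOn F (Ioc 0 T))
    (hFk : ∀ t : ℝ, 0 < t → IntegrableOn (fun s => (t - s) ^ (β - 1) * F s) (Ioc 0 t))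
    (hFb : Tendsto (fun t => t ^ β * F t) atTop (𝓝 b)) :
    Tendsto (abelIntegral β F) atTop (𝓝 (b * (Real.Gamma β * Real.Gamma (1 - β)))) := by
  set B := Real.Gamma β * Real.Gamma (1 - β) with hB
  have hB0 : 0 < B := Gamma_mul_Gamma_one_sub_pos hβ hβ1
  -- The Abel integral of b s^(-β) is exactly bB for every t > 0, so only a remainder with s^β E(s)
  -- → 0 is left.
  set E : ℝ → ℝ := fun s => F s - b * s ^ (-β) with hE
  have hEi : ∀ T : ℝ, 0 < T → IntegrableOn E (Ioc 0 T) := fun T hT =>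
    (hFi T hT).sub ((integrableOn_rpow_Ioc (by linarith) hT.le).const_mul b)
  have hsplit : ∀ t, 0 < t → abelIntegral β F t = abelIntegral β E t + b * B := by
    intro t ht
    obtain ⟨i, e⟩ := beta_integral_one_sub_symm hβ hβ1 ht
    have h := integral_sub (hFk t ht) (i.const_mul b)
    rw [integral_const_mul, e] at h
    have h2 : abelIntegral β E t =
        ∫ s in Ioc 0 t, ((t - s) ^ (β - 1) * F s - b * ((t - s) ^ (β - 1) * s ^ (-β))) := by
      refine setIntegral_congr_fun measurableSet_Ioc fun s _ => ?_
      simp only [hE]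
      ring
    rw [h2, h, abelIntegral]
    ring
  rw [Metric.tendsto_atTop]
  intro ε hε
  -- The tail contributes at most ηB = ε/2; the other half covers the piece over (0,T₀], which
  -- decays like (t-T₀)^(β-1).
  set η := ε / (2 * B) with hη
  have hη0 : 0 < η := by positivity
  obtain ⟨T, hT⟩ := Metric.tendsto_atTop.1 hFb η hη0
  set T₀ := max T 1 with hT₀
  have hT₀0 : 0 < T₀ := lt_max_of_lt_right one_pos
  have hEb : ∀ s, T₀ < s → |E s| ≤ η * s ^ (-β) := by
    intro s hs
    have hs0 : 0 < s := hT₀0.trans hs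
    have h := hT s ((le_max_left _ _).trans hs.le)
    rw [Real.dist_eq] at h
    have e : E s = s ^ (-β) * (s ^ β * F s - b) := by
      have : s ^ (-β) * s ^ β = 1 := by rw [← rpow_add hs0]; simp
      simp only [hE]
      linear_combination (-F s) * this
    rw [e, abs_mul, abs_of_nonneg (by positivity), mul_comm]
    exact mul_le_mul_of_nonneg_right h.le (by positivity)
  have hlim : Tendsto (fun t => (t - T₀) ^ (β - 1) * ∫ s in Ioc 0 T₀, |E s|) atTop (𝓝 0) := by
    have h1 : Tendsto (fun t : ℝ => t - T₀) atTop atTop := tendsto_atTop_add_const_right _ _ tendsto_id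
    have h2 := (tendsto_rpow_neg_atTop (by linarith : 0 < 1 - β)).comp h1
    have h3 := h2.mul_const (∫ s in Ioc 0 T₀, |E s|)
    simpa [Function.comp_def] using h3
  obtain ⟨N, hN⟩ := eventually_atTop.1 ((hlim.eventually_lt_const (half_pos hε)).and
    (eventually_gt_atTop T₀))
  refine ⟨N, fun t ht => ?_⟩
  obtain ⟨h1, h2⟩ := hN t ht
  have h3 := abs_abelIntegral_le hβ hβ1 hT₀0 h2 hη0.le (hEi T₀ hT₀0) (fun s hs _ => hEb s hs)
  rw [hsplit t (hT₀0.trans h2), Real.dist_eq, add_sub_cancel_right]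
  have h4 : η * B = ε / 2 := by rw [hη]; field_simp
  rw [← hB, h4] at h3
  linarith

/-- A solution of the Volterra equation whose right-hand side is bounded by
`s^(-β) (η |x(s)| + C)` with small `η` for large `s` stays bounded. -/
lemma volterra_solution_bounded {β x₀ η C T₀ : ℝ} {x F : ℝ → ℝ} (hβ : 0 < β) (hβ1 : β < 1)
    (hT₀ : 1 ≤ T₀) (hη : 0 ≤ η) (hη2 : η * Real.Gamma (1 - β) ≤ 1 / 2) (hC : 0 ≤ C)
    (hFi : IntegrableOn F (Ioc 0 T₀)) (hxc : ContinuousOn x (Ioi 0))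
    (hx : ∀ t, 0 < t → x t = x₀ * t ^ (β - 1) + 1 / Real.Gamma β * abelIntegral β F t)
    (hF : ∀ s, T₀ < s → |F s| ≤ (η * |x s| + C) * s ^ (-β)) :
    ∃ M : ℝ, 0 ≤ M ∧ ∀ t, T₀ ≤ t → |x t| ≤ M := by
  have hG := Real.Gamma_pos_of_pos hβ
  have hG' := Real.Gamma_pos_of_pos (by linarith : 0 < 1 - β)
  have hcont : ∀ S, ContinuousOn x (Icc T₀ S) := fun S =>
    hxc.mono fun s hs => (by linarith [hs.1] : 0 < s)
  -- Compactness handles [T₀, T₀+1], near whose left end (m-T₀)^(β-1) blows up; beyond it that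
  -- factor is at most 1.
  obtain ⟨B₀, hB₀⟩ := (isCompact_Icc (a := T₀) (b := T₀ + 1)).exists_bound_of_continuousOn
    (hcont _)
  set I := ∫ s in Ioc 0 T₀, |F s| with hI
  have hI0 : 0 ≤ I := integral_nonneg fun s => abs_nonneg _
  -- At a maximum point m > T₀ + 1 of |x| the estimate reads |x(m)| ≤ D/2 + |x(m)|/2.
  set D := 2 * (|x₀| + 1 / Real.Gamma β * I + C * Real.Gamma (1 - β)) with hD
  have hD0 : 0 ≤ D := by positivity
  refine ⟨max B₀ D, le_max_of_le_right hD0, fun t ht => ?_⟩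
  obtain ⟨m, hm, hmax⟩ := (isCompact_Icc (a := T₀) (b := t)).exists_isMaxOn
    ⟨t, ht, le_rfl⟩ (hcont t).abs
  refine (hmax ⟨ht, le_rfl⟩ : |x t| ≤ |x m|).trans ?_
  by_cases h : m ≤ T₀ + 1
  · exact le_max_of_le_left (hB₀ m ⟨hm.1, h⟩)
  · push Not at h
    refine le_max_of_le_right ?_
    have hm0 : 0 < m := by linarith
    have hA := abs_abelIntegral_le hβ hβ1 (by linarith : 0 < T₀) (by linarith : T₀ < m)
      (η := η * |x m| + C) (by positivity) hFi (fun s hs hsm => by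
        refine (hF s hs).trans ?_
        have : |x s| ≤ |x m| := hmax ⟨hs.le, hsm.trans hm.2⟩
        have hs0 : 0 < s := by linarith
        gcongr)
    have h1 : (m - T₀) ^ (β - 1) ≤ 1 :=
      rpow_le_one_of_one_le_of_nonpos (by linarith) (by linarith)
    have h2 : m ^ (β - 1) ≤ 1 := rpow_le_one_of_one_le_of_nonpos (by linarith) (by linarith)
    have h3 : |x m| ≤ |x₀| * 1 + 1 / Real.Gamma β * (1 * I +
        (η * |x m| + C) * (Real.Gamma β * Real.Gamma (1 - β))) := by
      conv_lhs => rw [hx m hm0]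
      refine (abs_add_le _ _).trans ?_
      rw [abs_mul, abs_mul, abs_of_nonneg (by positivity : 0 ≤ m ^ (β - 1)),
        abs_of_pos (by positivity : 0 < 1 / Real.Gamma β)]
      gcongr
      refine hA.trans ?_
      gcongr
    have h4 : 1 / Real.Gamma β * (1 * I + (η * |x m| + C) * (Real.Gamma β * Real.Gamma (1 - β))) =
        1 / Real.Gamma β * I + (η * Real.Gamma (1 - β)) * |x m| + C * Real.Gamma (1 - β) := by
      field_simp
      ring
    rw [h4] at h3
    have := mul_le_mul_of_nonneg_right hη2 (abs_nonneg (x m))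
    rw [hD]
    linarith

/-! ### Growth bounds from the two-sided estimate on f -/

lemma IsRealPower.abs_eq {μ : ℝ} {P : ℝ → ℝ} (hP : IsRealPower μ P) (x : ℝ) :
    |P x| = |x| ^ μ := by
  rcases le_or_gt 0 x with h | h
  · rw [hP.1 x h, abs_of_nonneg h, abs_of_nonneg (by positivity)]
  · exact hP.2 x h

lemma rpow_le_one_add {μ z : ℝ} (hμ₀ : 0 ≤ μ) (hμ₁ : μ ≤ 1) (hz : 0 ≤ z) : z ^ μ ≤ 1 + z := by
  rcases le_total z 1 with h | h
  · linarith [rpow_le_one hz h hμ₀]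
  · have := rpow_le_rpow_of_exponent_le h hμ₁
    rw [rpow_one] at this
    linarith

lemma abs_le_of_sandwich {u v L L₁ κ κ₁ : ℝ} (h1 : L₁ * v + κ₁ ≤ u) (h2 : u ≤ L * v + κ) :
    |u| ≤ (|L| + |L₁|) * |v| + (|κ| + |κ₁|) := by
  have a1 : |L * v| = |L| * |v| := abs_mul _ _
  have a2 : |L₁ * v| = |L₁| * |v| := abs_mul _ _
  have b1 := le_abs_self (L * v)
  have b2 := neg_abs_le (L₁ * v)
  have b3 := le_abs_self κ
  have b4 := neg_abs_le κ₁
  have c1 : 0 ≤ |L| * |v| := by positivity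
  have c2 : 0 ≤ |L₁| * |v| := by positivity
  have c3 := abs_nonneg κ
  have c4 := abs_nonneg κ₁
  rw [abs_le]
  constructor <;> linarith

/-- The weights on the coefficients come from (s^(β-1))^μ = s^(β-1) s^((1-μ)(1-β)) and 1 = s^(β-1)
s^(1-β); affine growth comes from |v|^μ ≤ 1 + |v|. -/
lemma weightedAffineGrowth_of_sandwich {β μ : ℝ} {P l l₁ k k₁ : ℝ → ℝ} {f : ℝ → ℝ → ℝ}
    (hμ₀ : 0 ≤ μ) (hμ₁ : μ ≤ 1) (hP : IsRealPower μ P)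
    (hf : ContinuousOn (fun q : ℝ × ℝ => f q.1 q.2) (Ioi 0 ×ˢ univ))
    (hfb : ∀ t x : ℝ, 0 < t → l₁ t * P x + k₁ t ≤ f t x ∧ f t x ≤ l t * P x + k t) :
    WeightedAffineGrowth β f (fun s =>
      (s ^ (β - 1) * |s ^ ((1 - μ) * (1 - β)) * l s| +
        s ^ (β - 1) * |s ^ ((1 - μ) * (1 - β)) * l₁ s|) +
      (s ^ (β - 1) * |s ^ (1 - β) * k s| + s ^ (β - 1) * |s ^ (1 - β) * k₁ s|)) := by
  refine ⟨hf, fun s v hs => ?_⟩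
  have h := hfb s (s ^ (β - 1) * v) hs
  refine (abs_le_of_sandwich h.1 h.2).trans ?_
  have hp : ∀ r : ℝ, |s ^ r| = s ^ r := fun r => abs_of_nonneg (by positivity)
  have e1 : s ^ (β - 1) * s ^ (1 - β) = 1 := by rw [← rpow_add hs]; simp
  have e2 : (s ^ (β - 1)) ^ μ = s ^ (β - 1) * s ^ ((1 - μ) * (1 - β)) := by
    rw [← rpow_mul hs.le, ← rpow_add hs]; congr 1; ring
  rw [hP.abs_eq, abs_mul, hp, mul_rpow (by positivity) (abs_nonneg v), e2]
  simp only [abs_mul, hp]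
  have hv := rpow_le_one_add hμ₀ hμ₁ (abs_nonneg v)
  have hv0 := abs_nonneg v
  have hκ : 0 ≤ (|k s| + |k₁ s|) * |v| := by positivity
  have hL : 0 ≤ (|l s| + |l₁ s|) * (s ^ (β - 1) * s ^ ((1 - μ) * (1 - β))) := by positivity
  calc _ = (|l s| + |l₁ s|) * (s ^ (β - 1) * s ^ ((1 - μ) * (1 - β))) * |v| ^ μ +
        (|k s| + |k₁ s|) := by ring
    _ ≤ (|l s| + |l₁ s|) * (s ^ (β - 1) * s ^ ((1 - μ) * (1 - β))) * (1 + |v|) +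
        ((|k s| + |k₁ s|) + (|k s| + |k₁ s|) * |v|) :=
      add_le_add (mul_le_mul_of_nonneg_left hv hL) (by linarith)
    _ = _ := by linear_combination (-(|k s| + |k₁ s|) * (1 + |v|)) * e1

/-- Decaying coefficients give a sandwiched right-hand side that is small relative to
`s^(-β) |x|`. -/
lemma exists_small_growth {β γ μ K b η : ℝ} {P l l₁ k k₁ : ℝ → ℝ} {f : ℝ → ℝ → ℝ}
    (hβγ : β < γ) (hμ₀ : 0 ≤ μ) (hμ₁ : μ ≤ 1) (hP : IsRealPower μ P)
    (hlK : ∀ t : ℝ, 1 ≤ t → t ^ γ * |l t| ≤ K) (hl₁K : ∀ t : ℝ, 1 ≤ t → t ^ γ * |l₁ t| ≤ K)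
    (hkb : Tendsto (fun t => t ^ β * k t) atTop (𝓝 b))
    (hk₁b : Tendsto (fun t => t ^ β * k₁ t) atTop (𝓝 b))
    (hfb : ∀ t x : ℝ, 0 < t → l₁ t * P x + k₁ t ≤ f t x ∧ f t x ≤ l t * P x + k t)
    (hη : 0 < η) : ∃ T₀ C : ℝ, 1 ≤ T₀ ∧ 0 ≤ C ∧ ∀ s x : ℝ, T₀ < s →
      |f s x| ≤ (η * |x| + C) * s ^ (-β) := by
  have h1 : ∀ᶠ s : ℝ in atTop, 2 * K * s ^ (-(γ - β)) ≤ η := by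
    have := (tendsto_rpow_neg_atTop (by linarith : 0 < γ - β)).const_mul (2 * K)
    rw [mul_zero] at this
    exact this.eventually_le_const hη
  have h2 := hkb.abs.eventually_le_const (lt_add_one |b|)
  have h3 := hk₁b.abs.eventually_le_const (lt_add_one |b|)
  obtain ⟨N, hN⟩ := eventually_atTop.1 ((h1.and h2).and h3)
  -- The term η comes from |P x| ≤ 1 + |x|, and the rest from |k| and |k₁|, each at most (|b|+1)
  -- s^(-β) for large s.
  refine ⟨max N 1, η + 2 * (|b| + 1), le_max_right _ _, by positivity, fun s x hs => ?_⟩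
  obtain ⟨⟨a1, a2⟩, a3⟩ := hN s ((le_max_left _ _).trans hs.le)
  have hs1 : 1 ≤ s := (le_max_right _ _).trans hs.le
  have hs0 : 0 < s := by linarith
  have h := hfb s x hs0
  refine (abs_le_of_sandwich h.1 h.2).trans ?_
  rw [hP.abs_eq]
  have hx := rpow_le_one_add hμ₀ hμ₁ (abs_nonneg x)
  have hp0 : 0 < s ^ (-β) := by positivity
  have e0 : s ^ (-β) * s ^ β = 1 := by rw [← rpow_add hs0]; simp
  rw [abs_mul, abs_of_nonneg (by positivity : 0 ≤ s ^ β)] at a2 a3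
  have bk : |k s| + |k₁ s| ≤ 2 * (|b| + 1) * s ^ (-β) := by
    have := mul_le_mul_of_nonneg_left (add_le_add a2 a3) hp0.le
    linear_combination this - (|k s| + |k₁ s|) * e0
  have bl : |l s| + |l₁ s| ≤ η * s ^ (-β) := by
    have e1 : s ^ (-γ) * s ^ γ = 1 := by rw [← rpow_add hs0]; simp
    have e2 : s ^ (-γ) = s ^ (-(γ - β)) * s ^ (-β) := by rw [← rpow_add hs0]; congr 1; ring
    have i1 := mul_le_mul_of_nonneg_left (add_le_add (hlK s hs1) (hl₁K s hs1))
      (by positivity : 0 ≤ s ^ (-γ))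
    have i2 := mul_le_mul_of_nonneg_right a1 hp0.le
    linear_combination i1 + i2 - (|l s| + |l₁ s|) * e1 + 2 * K * e2
  have := mul_le_mul bl hx (by positivity) (by positivity)
  linear_combination this + bk

/-! ### The main theorem -/

theorem theorem3p7 (β γ μ p K b : ℝ) (hβ : 0 < β) (hβγ : β < γ) (hγ : γ < 1)
    (hμ₀ : 0 ≤ μ) (hμ₁ : μ ≤ 1) (hp : 1 / β < p) (hK : 0 ≤ K)
    (P : ℝ → ℝ) (hP : IsRealPower μ P)
    (l l₁ k k₁ : ℝ → ℝ) (f : ℝ → ℝ → ℝ)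
    (hl : MemCLpLoc p (fun t => t ^ ((1 - μ) * (1 - β)) * l t))
    (hl₁ : MemCLpLoc p (fun t => t ^ ((1 - μ) * (1 - β)) * l₁ t))
    (hlK : ∀ t : ℝ, 1 ≤ t → t ^ γ * |l t| ≤ K)
    (hl₁K : ∀ t : ℝ, 1 ≤ t → t ^ γ * |l₁ t| ≤ K)
    (hk : MemCLpLoc p (fun t => t ^ (1 - β) * k t))
    (hk₁ : MemCLpLoc p (fun t => t ^ (1 - β) * k₁ t))
    (hkb : Tendsto (fun t => t ^ β * k t) atTop (𝓝 b))
    (hk₁b : Tendsto (fun t => t ^ β * k₁ t) atTop (𝓝 b))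
    (hf : ContinuousOn (fun q : ℝ × ℝ => f q.1 q.2) (Ioi 0 ×ˢ univ))
    (hfb : ∀ t x : ℝ, 0 < t →
      l₁ t * P x + k₁ t ≤ f t x ∧ f t x ≤ l t * P x + k t)
    (x₀ : ℝ) :
    ∃ x : ℝ → ℝ, MemCWeighted (1 - β) x ∧ IsRLSolution β f x₀ x ∧
      Tendsto x atTop (𝓝 (b * π / (Real.Gamma β * Real.sin (β * π)))) := by
  have hβ1 : β < 1 := hβγ.trans hγ
  have hG := Real.Gamma_pos_of_pos hβ
  have hG' := Real.Gamma_pos_of_pos (by linarith : 0 < 1 - β)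
  have hp1 : 1 < p := (one_lt_one_div hβ hβ1).trans hp
  have hpβ : 1 / p < β := (one_div_lt hβ (by linarith)).1 hp
  -- a > 1/p makes the L^p weights Abel weights of order a, and a < β leaves the surplus exponent β
  -- - a.
  obtain ⟨a, hpa, haβ⟩ := exists_between hpβ
  have ha : 0 < a := lt_trans (by positivity) hpa
  have hfg := weightedAffineGrowth_of_sandwich (β := β) hμ₀ hμ₁ hP hf hfb
  have hw : ∀ {h : ℝ → ℝ}, MemCLpLoc p h → AbelWeight β a (fun s => s ^ (β - 1) * |h s|) :=
    fun hh => abelWeight_of_memCLpLoc hβ hβ1 haβ.le hpa hp1 hh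
  have hφ := ((hw hl).add (hw hl₁)).add ((hw hk).add (hw hk₁))
  obtain ⟨x, hxc, hxb, hx⟩ := exists_volterra_solution x₀ hβ hβ1 ha haβ hfg hφ
  set F : ℝ → ℝ := fun s => f s (x s) with hF
  have hFc : ContinuousOn F (Ioi 0) := hfg.continuousOn_comp hxc
  have hFi : ∀ T : ℝ, 0 < T → IntegrableOn F (Ioc 0 T) := by
    intro T hT
    obtain ⟨M, hM, h⟩ := hxb T hT
    exact hφ.integrableOn (by linarith) hT hFc hM fun s hs hsT => (h s hs hsT).2
  have hFk : ∀ t : ℝ, 0 < t → IntegrableOn (fun s => (t - s) ^ (β - 1) * F s) (Ioc 0 t) := by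
    intro t ht
    obtain ⟨M, hM, h⟩ := hxb t ht
    obtain ⟨C, -, hC⟩ := hφ.abelIntegral_bound haβ.le ht
    exact (hC F M hFc hM (fun s hs hsT => (h s hs hsT).2) t ht le_rfl).1
  have hxi : ∀ T : ℝ, 0 < T → IntegrableOn x (Ioc 0 T) := by
    intro T hT
    obtain ⟨M, hM, h⟩ := hxb T hT
    refine ((integrableOn_rpow_Ioc (by linarith : -1 < β - 1) hT.le).const_mul M).mono'
      (aestronglyMeasurable_Ioc_of_continuousOn hxc T) ?_
    filter_upwards [ae_restrict_mem measurableSet_Ioc] with s hs using (h s hs.1 hs.2).1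
  have hinit : Tendsto (fun t => t ^ (1 - β) * x t) (𝓝[>] 0) (𝓝 x₀) := by
    obtain ⟨M, hM, h⟩ := hxb 1 one_pos
    obtain ⟨C, hC0, hC⟩ := hφ.abelIntegral_bound haβ.le one_pos
    have hlim : Tendsto (fun t : ℝ => 1 / Real.Gamma β * M * C * t ^ (β - a)) (𝓝[>] 0) (𝓝 0) := by
      have h1 : ContinuousAt (fun t : ℝ => t ^ (β - a)) 0 :=
        Real.continuousAt_rpow_const _ _ (Or.inr (by linarith))
      have h2 := (h1.tendsto.mono_left (nhdsWithin_le_nhds (s := Ioi 0))).const_mul (1 / Real.Gamma β * M * C)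
      rwa [zero_rpow (by linarith : β - a ≠ 0), mul_zero] at h2
    rw [tendsto_iff_dist_tendsto_zero]
    refine squeeze_zero' (Eventually.of_forall fun _ => dist_nonneg) ?_ hlim
    filter_upwards [Ioo_mem_nhdsGT (zero_lt_one' ℝ)] with t ht
    have ht0 := ht.1
    have e : t ^ (1 - β) * t ^ (β - 1) = 1 := by rw [← rpow_add ht0]; simp
    have e1 : t ^ (1 - β) * x t - x₀ = t ^ (1 - β) * (1 / Real.Gamma β * abelIntegral β F t) := by
      rw [hx t ht0]
      linear_combination x₀ * e
    have hb := (hC F M hFc hM (fun s hs hsT => (h s hs hsT).2) t ht0 ht.2.le).2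
    rw [Real.dist_eq, e1, abs_mul, abs_mul, abs_of_nonneg (by positivity : 0 ≤ t ^ (1 - β)),
      abs_of_pos (by positivity : 0 < 1 / Real.Gamma β)]
    calc _ ≤ t ^ (1 - β) * (1 / Real.Gamma β * (t ^ (β - a) * M * (C * t ^ (β - 1)))) := by
          gcongr
      _ = 1 / Real.Gamma β * M * C * t ^ (β - a) * (t ^ (1 - β) * t ^ (β - 1)) := by ring
      _ = _ := by rw [e, mul_one]
  refine ⟨x, ⟨hxc, x₀, hinit⟩, ⟨hasRLDeriv_of_volterra hβ hβ1 hFc hFi hxi hx, hinit⟩, ?_⟩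
  -- η = 1/(2Γ(1-β)) is the absorption threshold in the boundedness argument.
  obtain ⟨T₀, C, hT₀, hC, hfT⟩ := exists_small_growth hβγ hμ₀ hμ₁ hP hlK hl₁K hkb hk₁b hfb
    (by positivity : 0 < 1 / (2 * Real.Gamma (1 - β)))
  obtain ⟨M, hM, hxM⟩ := volterra_solution_bounded hβ hβ1 hT₀ (by positivity)
    (by field_simp; rfl) hC (hFi T₀ (by linarith)) hxc hx fun s hs => hfT s (x s) hs
  -- Boundedness of x now enters: with P(x(t)) bounded, the power term is O(t^(β-γ)) after
  -- multiplication by t^β.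
  have hsmall : ∀ L : ℝ → ℝ, (∀ t : ℝ, 1 ≤ t → t ^ γ * |L t| ≤ K) →
      Tendsto (fun t => t ^ β * (L t * P (x t))) atTop (𝓝 0) := by
    intro L hL
    have hlim := (tendsto_rpow_neg_atTop (by linarith : 0 < γ - β)).const_mul (K * (1 + M))
    rw [mul_zero] at hlim
    refine squeeze_zero_norm' ?_ hlim
    filter_upwards [eventually_ge_atTop T₀] with t ht
    have ht0 : 0 < t := by linarith
    have e : t ^ β = t ^ (-(γ - β)) * t ^ γ := by rw [← rpow_add ht0]; congr 1; ring
    have hPx : |P (x t)| ≤ 1 + M := by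
      rw [hP.abs_eq]
      exact (rpow_le_one_add hμ₀ hμ₁ (abs_nonneg _)).trans (by linarith [hxM t ht])
    rw [Real.norm_eq_abs, abs_mul, abs_mul, abs_of_nonneg (by positivity : 0 ≤ t ^ β), e]
    calc _ = t ^ (-(γ - β)) * (t ^ γ * |L t| * |P (x t)|) := by ring
      _ ≤ t ^ (-(γ - β)) * (K * (1 + M)) :=
        mul_le_mul_of_nonneg_left (mul_le_mul (hL t (by linarith)) hPx (abs_nonneg _) hK)
          (by positivity)
      _ = _ := by ring
  have hFlim : Tendsto (fun t => t ^ β * F t) atTop (𝓝 b) := by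
    have g1 := (hsmall l₁ hl₁K).add hk₁b
    have g2 := (hsmall l hlK).add hkb
    rw [zero_add] at g1 g2
    refine tendsto_of_tendsto_of_tendsto_of_le_of_le' g1 g2 ?_ ?_
    all_goals
      filter_upwards [eventually_gt_atTop 0] with t ht
      rw [← mul_add]
    · exact mul_le_mul_of_nonneg_left (hfb t (x t) ht).1 (by positivity)
    · exact mul_le_mul_of_nonneg_left (hfb t (x t) ht).2 (by positivity)
  have hA := tendsto_abelIntegral_atTop hβ hβ1 hFi hFk hFlim
  have h0 := (tendsto_rpow_neg_atTop (by linarith : 0 < 1 - β)).const_mul x₀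
  have hsum := h0.add (hA.const_mul (1 / Real.Gamma β))
  -- The initial-value term x₀ t^(β-1) vanishes at infinity, and the reflection formula rewrites
  -- Γ(β)Γ(1-β) as π / sin(πβ).
  have hval : x₀ * 0 + 1 / Real.Gamma β * (b * (Real.Gamma β * Real.Gamma (1 - β))) =
      b * π / (Real.Gamma β * Real.sin (β * π)) := by
    rw [Real.Gamma_mul_Gamma_one_sub, mul_comm β π, mul_zero, zero_add, mul_div_assoc',
      div_mul_div_comm, one_mul]
  rw [hval] at hsum
  refine hsum.congr' ?_
  filter_upwards [eventually_gt_atTop 0] with t ht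
  rw [hx t ht, neg_sub]
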